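/- Let an instance of Ball-3-SAT be a triple $(F,\alpha,r)$: a CNF formula $F$ over $n$ boolean variables (a finite set of clauses, each a set of at most three literals), a truth assignment $\alpha\in\{0,1\}^n$ and $r\in\mathbb{N}$. The question is whether some $\alpha^*\in\{0,1\}^n$ that satisfies $F$ has Hamming distance at most $r$ from $\alpha$. Let $\mathrm{Neg}(F)$ be the set of clauses of $F$ all of whose literals are false under $\alpha$; for $\alpha=(1,\dots,1)$ these are the clauses that have only negative literals. A $(3,3)$-CSP formula over $m$ variables is a conjunction of constraints over $m$ variables with values in a set of three elements, where each constraint is a disjunction of at most three literals of the form $(x\neq c)$. Consider the instances $(F,\alpha,r)$ for which $\mathrm{Neg}(F)$ consists of exactly $r$ clauses, each with exactly three literals, no two of which share a variable. On these instances: (a) there is a deterministic algorithm, with running time polynomial in $n$, that outputs a $(3,3)$-CSP formula over $r$ variables which is satisfiable if and only if the answer to $(F,\alpha,r)$ is yes; (b) there is a deterministic algorithm that decides Ball-3-SAT in time $O^*(2.077^r)$, that is, in at most $p(n)\cdot 2.077^r$ steps for some polynomial $p$ that does not depend on the instance. Time is counted on a machine with pointers: programs of first-order LISP on binary trees, where one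 step is one elementary operation (read the argument, nil, cons, head, tail, test for nil, function call). -/

import Mathlib

namespace BallSat

/-! ### CNF formulas and Ball-3-SAT -/

/-- A literal over the variables `0, …, n - 1`: `(x, true)` is the positive literal `x`,
and `(x, false)` is the negative literal `x̄`. -/
abbrev Literal (n : ℕ) : Type := Fin n × Bool

/-- A clause is a finite set of literals, read as their disjunction. -/
abbrev Clause (n : ℕ) : Type := Finset (Literal n)

/-- A CNF formula is a finite set of clauses, read as their conjunction. -/
abbrev Formula (n : ℕ) : Type := Finset (Clause n)

/-- A truth assignment to `n` variables (`true` is `1`, `false` is `0`). -/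
abbrev Assignment (n : ℕ) : Type := Fin n → Bool

/-- The literal `l` is true under `α`. -/
def Literal.Holds {n : ℕ} (α : Assignment n) (l : Literal n) : Prop := α l.1 = l.2

/-- `α` satisfies the clause `C`. -/
def Clause.Holds {n : ℕ} (α : Assignment n) (C : Clause n) : Prop :=
  ∃ l ∈ C, Literal.Holds α l

/-- `α` satisfies the formula `F`. -/
def Formula.Holds {n : ℕ} (α : Assignment n) (F : Formula n) : Prop :=
  ∀ C ∈ F, Clause.Holds α C

/-- The set of variables of a clause. -/
def Clause.vbl {n : ℕ} (C : Clause n) : Finset (Fin n) := C.image Prod.fst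

/-- `F` is a `k`-CNF formula: every clause has at most `k` literals. -/
def Formula.IsCNF {n : ℕ} (k : ℕ) (F : Formula n) : Prop := ∀ C ∈ F, C.card ≤ k

open Classical in
/-- `Neg(F)`, relative to the centre `α` of the ball: the clauses all of whose literals are false
under `α`. For `α = (1, …, 1)` these are the clauses with only negative literals. -/
noncomputable def Formula.neg {n : ℕ} (α : Assignment n) (F : Formula n) : Finset (Clause n) :=
  F.filter fun C => ∀ l ∈ C, ¬ Literal.Holds α l

/-- For the all-ones assignment, `Neg(F)` is the set of clauses with only negative literals. -/
theorem Formula.mem_neg_ones {n : ℕ} (F : Formula n) (C : Clause n) :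
    C ∈ Formula.neg (fun _ => true) F ↔ C ∈ F ∧ ∀ l ∈ C, l.2 = false := by
  simp [Formula.neg, Literal.Holds]

/-- `Neg(F)` consists of exactly `r` pairwise (variable-)disjoint 3-clauses. -/
def Formula.NegDisjoint {n : ℕ} (α : Assignment n) (F : Formula n) (r : ℕ) : Prop :=
  (Formula.neg α F).card = r ∧ (∀ C ∈ Formula.neg α F, C.card = 3) ∧
    ∀ C ∈ Formula.neg α F, ∀ D ∈ Formula.neg α F, C ≠ D → Disjoint C.vbl D.vbl

/-- The question of Ball-SAT: is there an assignment that satisfies `F` and has Hamming distance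
at most `r` from `α`? -/
def InBall {n : ℕ} (F : Formula n) (α : Assignment n) (r : ℕ) : Prop :=
  ∃ β : Assignment n, Formula.Holds β F ∧ hammingDist α β ≤ r

/-! ### Constraint satisfaction problems -/

/-- A CSP formula over `m` variables with values in a set of size `d`: a finite set of
constraints. A constraint is a finite set of pairs `(x, c)`, read as the disjunction of the
literals `x ≠ c`. -/
abbrev CSP (d m : ℕ) : Type := Finset (Finset (Fin m × Fin d))

/-- Every constraint has at most `k` literals, so that `G` is a `(d, k)`-CSP formula. -/
def CSP.HasWidth {d m : ℕ} (k : ℕ) (G : CSP d m) : Prop := ∀ C ∈ G, C.card ≤ k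

/-- Some assignment of values to the variables satisfies at least one literal of each
constraint. -/
def CSP.Satisfiable {d m : ℕ} (G : CSP d m) : Prop :=
  ∃ a : Fin m → Fin d, ∀ C ∈ G, ∃ l ∈ C, a l.1 ≠ l.2

/-! ### The model of computation

Deterministic programs of first-order LISP. The data are binary trees. A program is a finite list
of (mutually recursive) functions with one argument each; evaluation is by value. The elementary
operations are: read the argument, `nil`, `cons`, head, tail, a test for `nil`, and a function
call, and each of them costs one step. Trees are passed by reference, so that each step amounts to
a constant number of pointer operations. There is no arithmetic and no comparison of trees. -/

/-- Binary trees. -/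
inductive Data : Type
  | nil : Data
  | cons : Data → Data → Data

/-- The head of a pair (`nil` for `nil`). -/
def Data.hd : Data → Data
  | .nil => .nil
  | .cons a _ => a

/-- The tail of a pair (`nil` for `nil`). -/
def Data.tl : Data → Data
  | .nil => .nil
  | .cons _ b => b

/-- Expressions, which are the bodies of functions. -/
inductive Expr : Type
  /-- the argument of the function -/
  | arg : Expr
  /-- the empty tree -/
  | nil : Expr
  /-- a new pair -/
  | cons : Expr → Expr → Expr
  /-- the head of a pair -/
  | hd : Expr → Expr
  /-- the tail of a pair -/
  | tl : Expr → Expr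
  /-- `ite c a b` is `a` if the value of `c` is a pair, and `b` if it is `nil` -/
  | ite : Expr → Expr → Expr → Expr
  /-- `call f a` applies the `f`-th function of the program to the value of `a` -/
  | call : ℕ → Expr → Expr

/-- A program: the list of the bodies of its functions. -/
abbrev Program : Type := List Expr

/-- `Evaluates P x e v t`: in a call with argument `x`, the evaluation of `e` by the program `P`
terminates with value `v` after exactly `t` steps. -/
inductive Evaluates (P : Program) : Data → Expr → Data → ℕ → Prop
  | arg (x : Data) : Evaluates P x .arg x 1
  | nil (x : Data) : Evaluates P x .nil .nil 1
  | cons {x u v : Data} {a b : Expr} {s t : ℕ} :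
      Evaluates P x a u s → Evaluates P x b v t →
        Evaluates P x (.cons a b) (.cons u v) (s + t + 1)
  | hd {x u : Data} {a : Expr} {s : ℕ} :
      Evaluates P x a u s → Evaluates P x (.hd a) u.hd (s + 1)
  | tl {x u : Data} {a : Expr} {s : ℕ} :
      Evaluates P x a u s → Evaluates P x (.tl a) u.tl (s + 1)
  | ite_cons {x u w v : Data} {c a b : Expr} {s t : ℕ} :
      Evaluates P x c (.cons u w) s → Evaluates P x a v t →
        Evaluates P x (.ite c a b) v (s + t + 1)
  | ite_nil {x v : Data} {c a b : Expr} {s t : ℕ} :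
      Evaluates P x c .nil s → Evaluates P x b v t →
        Evaluates P x (.ite c a b) v (s + t + 1)
  | call {x u v : Data} {f : ℕ} {a e : Expr} {s t : ℕ} :
      Evaluates P x a u s → P[f]? = some e → Evaluates P u e v t →
        Evaluates P x (.call f a) v (s + t + 1)

/-- `P.Outputs x v t`: started on the input `x`, the first function of the program terminates
with output `v` after exactly `t` steps. -/
def Program.Outputs (P : Program) (x v : Data) (t : ℕ) : Prop :=
  Evaluates P x (.call 0 .arg) v t

/-- Evaluation is deterministic, in its value and in its number of steps. -/
theorem Evaluates.deterministic {P : Program} {x v v' : Data} {e : Expr} {t t' : ℕ}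
    (h : Evaluates P x e v t) (h' : Evaluates P x e v' t') : v = v' ∧ t = t' := by
  induction h generalizing v' t' with
  | arg x => cases h'; exact ⟨rfl, rfl⟩
  | nil x => cases h'; exact ⟨rfl, rfl⟩
  | cons _ _ ih₁ ih₂ =>
    cases h' with
    | cons k₁ k₂ =>
      obtain ⟨rfl, rfl⟩ := ih₁ k₁
      obtain ⟨rfl, rfl⟩ := ih₂ k₂
      exact ⟨rfl, rfl⟩
  | hd _ ih =>
    cases h' with
    | hd k => obtain ⟨rfl, rfl⟩ := ih k; exact ⟨rfl, rfl⟩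
  | tl _ ih =>
    cases h' with
    | tl k => obtain ⟨rfl, rfl⟩ := ih k; exact ⟨rfl, rfl⟩
  | ite_cons _ _ ih₁ ih₂ =>
    cases h' with
    | ite_cons k₁ k₂ =>
      obtain ⟨_, rfl⟩ := ih₁ k₁
      obtain ⟨rfl, rfl⟩ := ih₂ k₂
      exact ⟨rfl, rfl⟩
    | ite_nil k₁ k₂ => exact absurd (ih₁ k₁).1 (by simp)
  | ite_nil _ _ ih₁ ih₂ =>
    cases h' with
    | ite_cons k₁ k₂ => exact absurd (ih₁ k₁).1 (by simp)
    | ite_nil k₁ k₂ =>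
      obtain ⟨_, rfl⟩ := ih₁ k₁
      obtain ⟨rfl, rfl⟩ := ih₂ k₂
      exact ⟨rfl, rfl⟩
  | call _ hf _ ih₁ ih₂ =>
    cases h' with
    | call k₁ hf' k₂ =>
      obtain ⟨rfl, rfl⟩ := ih₁ k₁
      rw [hf, Option.some.injEq] at hf'
      subst hf'
      obtain ⟨rfl, rfl⟩ := ih₂ k₂
      exact ⟨rfl, rfl⟩

/-! ### Encoding of the instances as data -/

/-- Natural numbers, in unary. -/
def encNat : ℕ → Data
  | 0 => .nil
  | k + 1 => .cons .nil (encNat k)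

/-- Truth values. -/
def encBool : Bool → Data
  | false => .nil
  | true => .cons .nil .nil

/-- Lists, given an encoding of their entries. -/
def encList {β : Type} (enc : β → Data) : List β → Data
  | [] => .nil
  | a :: l => .cons (enc a) (encList enc l)

/-- The list of lists `L` writes down the set of sets `F`, in some order and possibly with
repetitions. -/
def Lists {β : Type} [DecidableEq β] (L : List (List β)) (F : Finset (Finset β)) : Prop :=
  (L.map List.toFinset).toFinset = F

/-- The list of lists `L` writes down the set of sets `F`, in some order and without
repetitions. -/
def ListsOnce {β : Type} [DecidableEq β] (L : List (List β)) (F : Finset (Finset β)) : Prop :=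
  Lists L F ∧ (L.map List.toFinset).Nodup ∧ ∀ C ∈ L, C.Nodup

/-- The instance of Ball-SAT with `n` variables whose formula is written down as `L`. -/
def encInstance (n : ℕ) (L : List (List (Literal n))) (α : Assignment n) (r : ℕ) : Data :=
  .cons (encNat n) (.cons (encNat r) (.cons (encList encBool (List.ofFn α))
    (encList (encList fun l : Literal n => .cons (encNat l.1) (encBool l.2)) L)))

/-- The CSP formula over `m` variables that is written down as `L`. -/
def encCSP (d m : ℕ) (L : List (List (Fin m × Fin d))) : Data :=
  .cons (encNat m)
    (encList (encList fun l : Fin m × Fin d => .cons (encNat l.1) (encNat l.2)) L)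

end BallSat

/-! Reduction. An assignment that satisfies `F` must flip a variable in each of the `r` false
clauses. These share no variables, so within distance `r` exactly one variable of each is flipped,
and nothing else. A candidate is thus a choice `A i : Fin 3` for every false clause `i`. A literal
true under `α` stays true iff its variable is not selected, which is `A i ≠ j` if the variable is
the `j`-th one of clause `i`, and no condition if it is in no false clause. A false literal becomes
true iff its variable is selected, which is `A i = j`, that is, `A i ≠ j + 1` and `A i ≠ j + 2`. A
clause is a disjunction of at most three such conjunctions; distributing gives constraints of width
three. This is `satisfiable_reduction_iff`.

Decision. Measure the distance from `c` to `x` by the sum of the residues `x i - c i` in `{0, 1,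
2}`. If a constraint is violated at the current point, the target differs from that point at one of
its at most three variables, and incrementing this variable lowers the distance by exactly one,
whatever the target value is (`val_sub_add_one`). Search within radius `s` therefore has at most `3
^ s` leaves. Since `∑ x, (1/3) ^ weight x = (1 + 1/3 + 1/9) ^ b = (13/9) ^ b`, some sphere is large
relative to `3 ^ s`, and a greedy choice of its translates covers `(ℤ/3)^b` at total cost `(27/13) ^
b` up to a polynomial in `b` (`exists_code`). As `27/13 < 2.077`, a constant block length `b`
absorbs the polynomial (`exists_block_length`), and the code is a constant of the program. The
search fills the variables block by block with codewords, adds up the radii, and then corrects;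
fewer than `b` leftover variables are tried exhaustively at the cost of a constant factor.

Machine. `TimeBound` says that code for a function can be placed behind any program of known length
and be followed by any other code, so that absolute function indices survive composition. `PolyC`
adds polynomial bounds on time and output size, and is closed under the constructions used.
`TimeBound.search` charges a depth-first search by its number of nodes, which
`sum_nodeBound_children` bounds. -/

namespace BallSat

/-! ### Time-bounded evaluation -/

/-- The evaluation of `e` on the argument `x` terminates with value `v` in at most `T` steps. -/
def EvalsIn (P : Program) (x : Data) (e : Expr) (v : Data) (T : ℕ) : Prop :=
  ∃ t ≤ T, Evaluates P x e v t

namespace EvalsIn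

variable {P : Program} {x u v w : Data} {a b c e : Expr} {S T U : ℕ}

theorem mono (h : EvalsIn P x e v S) (hST : S ≤ T) : EvalsIn P x e v T :=
  let ⟨t, ht, h⟩ := h
  ⟨t, ht.trans hST, h⟩

theorem arg : EvalsIn P x .arg x 1 := ⟨1, le_rfl, .arg x⟩

theorem nil : EvalsIn P x .nil .nil 1 := ⟨1, le_rfl, .nil x⟩

theorem cons (h : EvalsIn P x a u S) (k : EvalsIn P x b v T) :
    EvalsIn P x (.cons a b) (.cons u v) (S + T + 1) := by
  obtain ⟨s, hs, h⟩ := h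
  obtain ⟨t, ht, k⟩ := k
  exact ⟨_, by omega, .cons h k⟩

theorem hd (h : EvalsIn P x a u S) : EvalsIn P x (.hd a) u.hd (S + 1) := by
  obtain ⟨s, hs, h⟩ := h
  exact ⟨_, by omega, .hd h⟩

theorem tl (h : EvalsIn P x a u S) : EvalsIn P x (.tl a) u.tl (S + 1) := by
  obtain ⟨s, hs, h⟩ := h
  exact ⟨_, by omega, .tl h⟩

theorem ite_cons (h : EvalsIn P x c (.cons u w) S) (k : EvalsIn P x a v T) :
    EvalsIn P x (.ite c a b) v (S + T + 1) := by
  obtain ⟨s, hs, h⟩ := h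
  obtain ⟨t, ht, k⟩ := k
  exact ⟨_, by omega, .ite_cons h k⟩

theorem ite_nil (h : EvalsIn P x c .nil S) (k : EvalsIn P x b v T) :
    EvalsIn P x (.ite c a b) v (S + T + 1) := by
  obtain ⟨s, hs, h⟩ := h
  obtain ⟨t, ht, k⟩ := k
  exact ⟨_, by omega, .ite_nil h k⟩

theorem call {f : ℕ} (h : EvalsIn P x a u S) (hf : P[f]? = some e) (k : EvalsIn P u e v T) :
    EvalsIn P x (.call f a) v (S + T + 1) := by
  obtain ⟨s, hs, h⟩ := h
  obtain ⟨t, ht, k⟩ := k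
  exact ⟨_, by omega, .call h hf k⟩

end EvalsIn

/-! ### Types with an encoding -/

/-- The number of pairs of a tree. -/
def Data.size : Data → ℕ
  | .nil => 0
  | .cons a b => a.size + b.size + 1

/-- A type whose elements are encoded as trees. -/
class Enc (A : Type) where
  /-- the encoding -/
  enc : A → Data



open Enc (enc)

instance : Enc Data := ⟨id⟩
instance : Enc ℕ := ⟨encNat⟩
instance : Enc Bool := ⟨encBool⟩
instance {k : ℕ} : Enc (Fin k) := ⟨fun i => encNat i⟩
instance {A : Type} [Enc A] : Enc (List A) := ⟨encList enc⟩
instance {A B : Type} [Enc A] [Enc B] : Enc (A × B) := ⟨fun p => .cons (enc p.1) (enc p.2)⟩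

section Sizes

variable {A B : Type} [Enc A] [Enc B]

/-- The size of the encoding. -/
def sz (a : A) : ℕ := (enc a).size

@[simp] theorem enc_list_nil : enc ([] : List A) = .nil := rfl
@[simp] theorem enc_list_cons (a : A) (l : List A) : enc (a :: l) = .cons (enc a) (enc l) := rfl
@[simp] theorem enc_true : enc true = .cons .nil .nil := rfl
@[simp] theorem enc_false : enc false = .nil := rfl

@[simp] theorem sz_pair (a : A) (b : B) : sz (a, b) = sz a + sz b + 1 := rfl
@[simp] theorem sz_nil : sz ([] : List A) = 0 := rfl
@[simp] theorem sz_cons (a : A) (l : List A) : sz (a :: l) = sz a + sz l + 1 := rfl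

@[simp] theorem sz_nat (n : ℕ) : sz n = n := by
  induction n with
  | zero => rfl
  | succ n ih =>
    change 0 + sz n + 1 = n + 1
    omega

theorem sz_bool_le (b : Bool) : sz b ≤ 1 := by cases b <;> decide

@[simp] theorem sz_fin {k : ℕ} (i : Fin k) : sz i = i := sz_nat i

theorem length_le_sz (l : List A) : l.length ≤ sz l := by
  induction l with
  | nil => simp
  | cons a l ih => simp; omega

theorem sz_le_of_mem {a : A} {l : List A} (h : a ∈ l) : sz a ≤ sz l := by
  induction l with
  | nil => simp at h
  | cons b l ih =>
    rcases List.mem_cons.1 h with rfl | h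
    · simp; omega
    · have := ih h
      simp; omega

theorem sz_le_of_suffix {l l' : List A} (h : l' <:+ l) : sz l' ≤ sz l := by
  obtain ⟨t, rfl⟩ := h
  induction t with
  | nil => simp
  | cons a t ih => simp; omega

theorem sz_append (l l' : List A) : sz (l ++ l') = sz l + sz l' := by
  induction l with
  | nil => simp
  | cons a l ih => simp [ih]; omega

theorem sz_le_length_mul {l : List A} {M : ℕ} (h : ∀ a ∈ l, sz a ≤ M) :
    sz l ≤ l.length * (M + 1) := by
  induction l with
  | nil => simp
  | cons a l ih =>
    have h₁ := h a (by simp)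
    have h₂ := ih fun b hb => h b (by simp [hb])
    simp only [sz_cons, List.length_cons, Nat.succ_mul]
    omega

end Sizes

/-! ### Polynomial bounds -/

/-- `g` is bounded by a polynomial in `m`. -/
def PolyB {A : Type} (m g : A → ℕ) : Prop := ∃ k, ∀ a, g a ≤ (m a + 2) ^ k

namespace PolyB

variable {A B : Type} {m g h : A → ℕ}

theorem refl (m : A → ℕ) : PolyB m m := ⟨1, fun a => by simp⟩

theorem of_le (hh : PolyB m h) (hgh : ∀ a, g a ≤ h a) : PolyB m g :=
  let ⟨k, hk⟩ := hh
  ⟨k, fun a => (hgh a).trans (hk a)⟩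

theorem const (m : A → ℕ) (c : ℕ) : PolyB m fun _ => c :=
  ⟨c, fun a => (Nat.lt_two_pow_self (n := c)).le.trans (Nat.pow_le_pow_left (by omega) c)⟩

theorem mul (hg : PolyB m g) (hh : PolyB m h) : PolyB m fun a => g a * h a := by
  obtain ⟨k, hk⟩ := hg
  obtain ⟨l, hl⟩ := hh
  exact ⟨k + l, fun a => by rw [pow_add]; exact Nat.mul_le_mul (hk a) (hl a)⟩

theorem add (hg : PolyB m g) (hh : PolyB m h) : PolyB m fun a => g a + h a := by
  obtain ⟨k, hk⟩ := hg
  obtain ⟨l, hl⟩ := hh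
  -- The additional factor `m a + 2` is at least 2 and pays for the two summands; this is why the
  -- base is not `m a` itself.
  refine ⟨k + l + 1, fun a => ?_⟩
  have h₁ : (m a + 2) ^ k ≤ (m a + 2) ^ (k + l) := Nat.pow_le_pow_right (by omega) (by omega)
  have h₂ : (m a + 2) ^ l ≤ (m a + 2) ^ (k + l) := Nat.pow_le_pow_right (by omega) (by omega)
  have h₃ := hk a
  have h₄ := hl a
  rw [pow_succ]
  nlinarith [Nat.zero_le (m a * (m a + 2) ^ (k + l))]

theorem pow (hg : PolyB m g) (c : ℕ) : PolyB m fun a => g a ^ c := by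
  obtain ⟨k, hk⟩ := hg
  exact ⟨k * c, fun a => by rw [pow_mul]; exact Nat.pow_le_pow_left (hk a) c⟩

theorem trans {g : A → ℕ} (hg : PolyB m g) (hh : PolyB g h) : PolyB m h := by
  obtain ⟨k, hk⟩ := hh
  exact ((hg.add (const m 2)).pow k).of_le hk

theorem comp {m' g' : B → ℕ} (h : PolyB m' g') (f : A → B) :
    PolyB (fun a => m' (f a)) fun a => g' (f a) :=
  let ⟨k, hk⟩ := h
  ⟨k, fun a => hk (f a)⟩

end PolyB

/-! ### Functions computed by extensible programs -/

/-- The function `f` can be computed in time `T`: given any number `n` of functions defined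
already, one can define further functions `Q` and an expression `e` with value `f`. -/
def TimeBound {A B : Type} [Enc A] [Enc B] (f : A → B) (T : A → ℕ) : Prop :=
  ∀ n : ℕ, ∃ (Q : Program) (e : Expr), ∀ P R : Program, P.length = n →
    ∀ a : A, EvalsIn (P ++ Q ++ R) (enc a) e (enc (f a)) (T a)

namespace TimeBound

variable {A B C D : Type} [Enc A] [Enc B] [Enc C] [Enc D]

/-- The expression may be taken to be the body of a function. -/
theorem exists_function {f : A → B} {T : A → ℕ} (h : TimeBound f T) (n : ℕ) :
    ∃ (Q : Program) (i : ℕ), ∀ P R : Program, P.length = n →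
      ∃ e, (P ++ Q ++ R)[i]? = some e ∧
        ∀ a : A, EvalsIn (P ++ Q ++ R) (enc a) e (enc (f a)) (T a) := by
  obtain ⟨Q, e, h⟩ := h n
  refine ⟨Q ++ [e], n + Q.length, fun P R hP => ⟨e, ?_, fun a => ?_⟩⟩
  · rw [List.append_assoc, List.append_assoc, List.getElem?_append_right (by omega),
      List.getElem?_append_right (by omega)]
    simp [hP]
  · simpa using h P ([e] ++ R) hP a

theorem mono {f : A → B} {T U : A → ℕ} (h : TimeBound f T) (hTU : ∀ a, T a ≤ U a) :
    TimeBound f U := by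
  intro n
  obtain ⟨Q, e, h⟩ := h n
  exact ⟨Q, e, fun P R hP a => (h P R hP a).mono (hTU a)⟩

/-- Programs see only trees, so a program for `f` serves every function with the same encoded
values, even in another type. -/
theorem cast {f : A → B} {g : A → C} {T : A → ℕ} (h : TimeBound f T)
    (hfg : ∀ a, enc (g a) = enc (f a)) : TimeBound g T := by
  intro n
  obtain ⟨Q, e, h⟩ := h n
  exact ⟨Q, e, fun P R hP a => by rw [hfg]; exact h P R hP a⟩

/-- A function without calls of its own. -/
theorem of_expr {f : A → B} {T : A → ℕ} (e : Expr)
    (h : ∀ P a, EvalsIn P (enc a) e (enc (f a)) (T a)) : TimeBound f T :=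
  fun _ => ⟨[], e, fun _ _ _ _ => h _ _⟩

theorem id : TimeBound (fun a : A => a) fun _ => 1 := of_expr .arg fun _ _ => .arg

theorem map_expr {f : A → B} {g : A → C} {T : A → ℕ} (E : Expr → Expr) (c : ℕ)
    (hE : ∀ P x e a t, EvalsIn P x e (enc (f a)) t → EvalsIn P x (E e) (enc (g a)) (t + c))
    (h : TimeBound f T) : TimeBound g fun a => T a + c := by
  intro n
  obtain ⟨Q, e, h⟩ := h n
  exact ⟨Q, E e, fun P R hP a => hE _ _ _ _ _ (h P R hP a)⟩

theorem fst {f : A → B × C} {T : A → ℕ} (h : TimeBound f T) :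
    TimeBound (fun a => (f a).1) fun a => T a + 1 :=
  h.map_expr (f := f) .hd 1 fun _ _ _ _ _ k => k.hd

theorem snd {f : A → B × C} {T : A → ℕ} (h : TimeBound f T) :
    TimeBound (fun a => (f a).2) fun a => T a + 1 :=
  h.map_expr (f := f) .tl 1 fun _ _ _ _ _ k => k.tl

theorem map₂_expr {f : A → B} {g : A → C} {h : A → D} {T U : A → ℕ} (E : Expr → Expr → Expr)
    (c : ℕ)
    (hE : ∀ P x e e' a t t', EvalsIn P x e (enc (f a)) t → EvalsIn P x e' (enc (g a)) t' →
      EvalsIn P x (E e e') (enc (h a)) (t + t' + c))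
    (hf : TimeBound f T) (hg : TimeBound g U) : TimeBound h fun a => T a + U a + c := by
  intro n
  obtain ⟨Q, e, hf⟩ := hf n
  obtain ⟨Q', e', hg⟩ := hg (n + Q.length)
  refine ⟨Q ++ Q', E e e', fun P R hP a => hE _ _ _ _ _ _ _ ?_ ?_⟩
  · simpa using hf P (Q' ++ R) hP a
  · simpa using hg (P ++ Q) R (by simp [hP]) a

theorem pair {f : A → B} {g : A → C} {T U : A → ℕ} (hf : TimeBound f T) (hg : TimeBound g U) :
    TimeBound (fun a => (f a, g a)) fun a => T a + U a + 1 :=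
  map₂_expr .cons 1 (fun _ _ _ _ _ _ _ h k => h.cons k) hf hg

theorem comp {f : A → B} {g : B → C} {T : A → ℕ} {U : B → ℕ} (hg : TimeBound g U)
    (hf : TimeBound f T) : TimeBound (fun a => g (f a)) fun a => T a + U (f a) + 1 := by
  intro n
  obtain ⟨Q, e, hf⟩ := hf n
  obtain ⟨Q', i, hg⟩ := hg.exists_function (n + Q.length)
  refine ⟨Q ++ Q', .call i e, fun P R hP a => ?_⟩
  obtain ⟨e', hi, hg⟩ := hg (P ++ Q) R (by simp [hP])
  have hf := hf P (Q' ++ R) hP a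
  simp only [List.append_assoc] at hf hi hg ⊢
  exact hf.call hi (hg _)

theorem ite {c : A → Bool} {f g : A → B} {S T U : A → ℕ} (hc : TimeBound c S)
    (hf : TimeBound f T) (hg : TimeBound g U) :
    TimeBound (fun a => if c a then f a else g a) fun a => S a + T a + U a + 1 := by
  intro n
  obtain ⟨Q, e, hc⟩ := hc n
  obtain ⟨Q', e', hf⟩ := hf (n + Q.length)
  obtain ⟨Q'', e'', hg⟩ := hg (n + Q.length + Q'.length)
  refine ⟨Q ++ Q' ++ Q'', .ite e e' e'', fun P R hP a => ?_⟩
  have hc := hc P (Q' ++ Q'' ++ R) hP a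
  have hf := hf (P ++ Q) (Q'' ++ R) (by simp [hP]) a
  have hg := hg (P ++ Q ++ Q') R (by simp [hP]; omega) a
  simp only [List.append_assoc] at hc hf hg ⊢
  cases h : c a with
  | true => rw [h] at hc; exact (hc.ite_cons hf).mono (by omega)
  | false => rw [h] at hc; exact (hc.ite_nil hg).mono (by omega)

/-- The time of a recursion over a list. -/
def foldrTime (f : A × B × C → C) (i : A → C) (T : A × B × C → ℕ) (U : A → ℕ) (a : A) :
    List B → ℕ
  | [] => U a + 6
  | b :: l => foldrTime f i T U a l + T (a, b, l.foldr (fun b c => f (a, b, c)) (i a)) + 18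

theorem foldr {f : A × B × C → C} {i : A → C} {l : A → List B} {T : A × B × C → ℕ}
    {U V : A → ℕ} (hl : TimeBound l V) (hi : TimeBound i U) (hf : TimeBound f T) :
    TimeBound (fun a => (l a).foldr (fun b c => f (a, b, c)) (i a))
      fun a => V a + foldrTime f i T U a (l a) + 3 := by
  intro n
  obtain ⟨Q, e, hl⟩ := hl n
  obtain ⟨Q', i', hi⟩ := hi.exists_function (n + Q.length)
  obtain ⟨Q'', f', hf⟩ := hf.exists_function (n + Q.length + Q'.length)
  -- `k` is the index at which `body` itself will be placed, so `call k` in `body` is the recursion.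
  -- Its argument is the pair of the environment and the remaining list.
  let k := n + Q.length + Q'.length + Q''.length
  let body : Expr := .ite (.tl .arg) (.call f' (.cons (.hd .arg) (.cons (.hd (.tl .arg))
    (.call k (.cons (.hd .arg) (.tl (.tl .arg))))))) (.call i' (.hd .arg))
  refine ⟨Q ++ Q' ++ Q'' ++ [body], .call k (.cons .arg e), fun P R hP a => ?_⟩
  have hl := hl P (Q' ++ Q'' ++ [body] ++ R) hP a
  obtain ⟨ei, hi', hi⟩ := hi (P ++ Q) (Q'' ++ [body] ++ R) (by simp [hP])
  obtain ⟨ef, hf', hf⟩ := hf (P ++ Q ++ Q') ([body] ++ R) (by simp [hP]; omega)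
  have hk : (P ++ (Q ++ Q' ++ Q'' ++ [body]) ++ R)[k]? = some body := by
    have : P ++ (Q ++ Q' ++ Q'' ++ [body]) ++ R = (P ++ Q ++ Q' ++ Q'') ++ (body :: R) := by simp
    rw [this, List.getElem?_append_right (by simp [k, hP]; omega)]
    simp [k, hP, ← add_assoc]
  simp only [List.append_assoc] at hl hi' hi hf' hf hk ⊢
  generalize P ++ (Q ++ (Q' ++ (Q'' ++ ([body] ++ R)))) = P' at *
  have key : ∀ l : List B, EvalsIn P' (.cons (enc a) (enc l)) body
      (enc (l.foldr (fun b c => f (a, b, c)) (i a))) (foldrTime f i T U a l) := by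
    intro l
    induction l with
    | nil =>
      refine EvalsIn.mono (EvalsIn.ite_nil (EvalsIn.tl .arg)
        ((EvalsIn.hd .arg).call hi' (hi a))) ?_
      simp only [foldrTime]
      omega
    | cons b l ih =>
      have h := ((EvalsIn.hd .arg).cons (EvalsIn.tl (EvalsIn.tl .arg)) :
        EvalsIn P' (.cons (enc a) (enc (b :: l))) _ _ _).call hk ih
      have h := (EvalsIn.hd (x := .cons (enc a) (enc (b :: l))) .arg).cons
        ((EvalsIn.hd (EvalsIn.tl .arg)).cons h)
      refine EvalsIn.mono (EvalsIn.ite_cons (EvalsIn.tl .arg) (h.call hf' (hf (a, b, _)))) ?_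
      simp only [foldrTime]
      omega
  exact ((EvalsIn.arg.cons hl).call hk (key (l a))).mono (by omega)

end TimeBound

/-! ### Functions computed in polynomial time -/

/-- `f` is computed in polynomial time, with values of polynomial size. -/
def PolyC {A B : Type} [Enc A] [Enc B] (f : A → B) : Prop :=
  PolyB (sz (A := A)) (fun a => sz (f a)) ∧ ∃ T, PolyB (sz (A := A)) T ∧ TimeBound f T

namespace PolyC

variable {A B C D : Type} [Enc A] [Enc B] [Enc C] [Enc D]

theorem cast {f : A → B} {g : A → C} (h : PolyC f) (hfg : ∀ a, enc (g a) = enc (f a)) :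
    PolyC g := by
  obtain ⟨h, T, hT, hf⟩ := h
  exact ⟨h.of_le fun a => by simp [sz, hfg], T, hT, hf.cast hfg⟩

theorem id : PolyC fun a : A => a := ⟨.refl _, _, .const _ 1, .id⟩

theorem const (b : B) : PolyC fun _ : A => b := by
  refine ⟨.const _ _, ?_⟩
  suffices ∀ d : Data, ∃ T, TimeBound (fun _ : A => d) fun _ => T by
    obtain ⟨T, h⟩ := this (enc b)
    exact ⟨_, .const _ T, h.cast fun _ => rfl⟩
  intro d
  induction d with
  | nil => exact ⟨1, .of_expr .nil fun _ _ => .nil⟩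
  | cons u v ih₁ ih₂ =>
    obtain ⟨S, h₁⟩ := ih₁
    obtain ⟨T, h₂⟩ := ih₂
    exact ⟨_, (h₁.pair h₂).cast fun _ => rfl⟩

theorem fst {f : A → B × C} (h : PolyC f) : PolyC fun a => (f a).1 := by
  obtain ⟨h, T, hT, hf⟩ := h
  exact ⟨h.of_le fun a => show sz (f a).1 ≤ sz (f a).1 + sz (f a).2 + 1 by omega,
    _, hT.add (.const _ 1), hf.fst⟩

theorem snd {f : A → B × C} (h : PolyC f) : PolyC fun a => (f a).2 := by
  obtain ⟨h, T, hT, hf⟩ := h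
  exact ⟨h.of_le fun a => show sz (f a).2 ≤ sz (f a).1 + sz (f a).2 + 1 by omega,
    _, hT.add (.const _ 1), hf.snd⟩

theorem pair {f : A → B} {g : A → C} (hf : PolyC f) (hg : PolyC g) :
    PolyC fun a => (f a, g a) := by
  obtain ⟨hf, T, hT, hf'⟩ := hf
  obtain ⟨hg, U, hU, hg'⟩ := hg
  exact ⟨(hf.add hg).add (.const _ 1), _, (hT.add hU).add (.const _ 1), hf'.pair hg'⟩

theorem comp {g : B → C} {f : A → B} (hg : PolyC g) (hf : PolyC f) : PolyC fun a => g (f a) := by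
  obtain ⟨hf, T, hT, hf'⟩ := hf
  obtain ⟨hg, U, hU, hg'⟩ := hg
  exact ⟨hf.trans (hg.comp f), _, (hT.add (hf.trans (hU.comp f))).add (.const _ 1), hg'.comp hf'⟩

theorem comp₂ {g : B → C → D} (hg : PolyC fun p : B × C => g p.1 p.2) {f : A → B} {f' : A → C}
    (hf : PolyC f) (hf' : PolyC f') : PolyC fun a => g (f a) (f' a) :=
  hg.comp (hf.pair hf')

theorem ite {c : A → Bool} {f g : A → B} (hc : PolyC c) (hf : PolyC f) (hg : PolyC g) :
    PolyC fun a => if c a then f a else g a := by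
  obtain ⟨-, S, hS, hc'⟩ := hc
  obtain ⟨hf, T, hT, hf'⟩ := hf
  obtain ⟨hg, U, hU, hg'⟩ := hg
  refine ⟨(hf.add hg).of_le fun a => ?_, _, ((hS.add hT).add hU).add (.const _ 1),
    hc'.ite hf' hg'⟩
  dsimp only
  split <;> omega

/-- The bound `S` on all intermediate values cannot be dropped: a polynomial-time step, repeated
along a list, may produce values of exponential size. -/
theorem foldr {f : A × B × C → C} {i : A → C} {l : A → List B} (hl : PolyC l) (hi : PolyC i)
    (hf : PolyC f) {S : A → ℕ} (hS : PolyB (sz (A := A)) S)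
    (hfS : ∀ a l', l' <:+ l a → sz (l'.foldr (fun b c => f (a, b, c)) (i a)) ≤ S a) :
    PolyC fun a => (l a).foldr (fun b c => f (a, b, c)) (i a) := by
  obtain ⟨hl, V, hV, hl'⟩ := hl
  obtain ⟨-, U, hU, hi'⟩ := hi
  obtain ⟨-, T, ⟨k, hT⟩, hf'⟩ := hf
  let M : A → ℕ := fun a => (sz a + sz (l a) + S a + 4) ^ k
  have hM : PolyB (sz (A := A)) M :=
    ((((PolyB.refl _).add hl).add hS).add (.const _ 4)).pow k
  have key : ∀ a l', l' <:+ l a →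
      TimeBound.foldrTime f i T U a l' ≤ l'.length * (M a + 18) + U a + 6 := by
    intro a l' h
    induction l' with
    | nil => simp [TimeBound.foldrTime]
    | cons b l' ih =>
      have h' : l' <:+ l a := (List.suffix_cons b l').trans h
      have ih := ih h'
      have hT : T (a, b, l'.foldr (fun b c => f (a, b, c)) (i a)) ≤ M a := by
        refine (hT _).trans (Nat.pow_le_pow_left ?_ k)
        have h₁ := hfS a l' h'
        have h₂ : sz b ≤ sz (l a) := sz_le_of_mem (h.subset (by simp))
        simp only [sz_pair]
        omega
      simp only [TimeBound.foldrTime, List.length_cons, Nat.succ_mul]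
      omega
  refine ⟨hS.of_le fun a => hfS a _ List.suffix_rfl,
    fun a => V a + (sz (l a) * (M a + 18) + U a + 6) + 3,
    (hV.add (((hl.mul (hM.add (.const _ 18))).add hU).add (.const _ 6))).add (.const _ 3),
    (hl'.foldr hi' hf').mono fun a => ?_⟩
  have h₁ := key a _ List.suffix_rfl
  have h₂ := Nat.mul_le_mul_right (M a + 18) (length_le_sz (l a))
  omega

/-- Recursion over a list, where the accumulated value grows by a polynomial amount that does not
depend on it. -/
theorem foldr_of_add {f : A × B × C → C} {i : A → C} {l : A → List B} (hl : PolyC l)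
    (hi : PolyC i) (hf : PolyC f) {D : A × B → ℕ} (hD : PolyB (sz (A := A × B)) D)
    (hfD : ∀ a b c, sz (f (a, b, c)) ≤ sz c + D (a, b)) :
    PolyC fun a => (l a).foldr (fun b c => f (a, b, c)) (i a) := by
  obtain ⟨k, hD⟩ := hD
  let M : A → ℕ := fun a => (sz a + sz (l a) + 3) ^ k
  have hM : PolyB (sz (A := A)) M := (((PolyB.refl _).add hl.1).add (.const _ 3)).pow k
  refine foldr hl hi hf (S := fun a => sz (i a) + sz (l a) * M a) (hi.1.add (hl.1.mul hM)) ?_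
  intro a l' h
  have key : sz (l'.foldr (fun b c => f (a, b, c)) (i a)) ≤ sz (i a) + l'.length * M a := by
    induction l' with
    | nil => simp
    | cons b l' ih =>
      have ih := ih ((List.suffix_cons b l').trans h)
      have hM : D (a, b) ≤ M a := by
        refine (hD _).trans (Nat.pow_le_pow_left ?_ k)
        have h₂ : sz b ≤ sz (l a) := sz_le_of_mem (h.subset (by simp))
        simp only [sz_pair]
        omega
      have := hfD a b (l'.foldr (fun b c => f (a, b, c)) (i a))
      simp only [List.foldr_cons, List.length_cons, Nat.succ_mul]
      omega
  have := Nat.mul_le_mul_right (M a) ((length_le_sz l').trans (sz_le_of_suffix h))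
  omega

/-! #### Truth values -/

theorem not {f : A → Bool} (hf : PolyC f) : PolyC fun a => !f a :=
  (hf.ite (const false) (const true)).cast fun a => by cases f a <;> rfl

theorem and {f g : A → Bool} (hf : PolyC f) (hg : PolyC g) : PolyC fun a => f a && g a :=
  (hf.ite hg (const false)).cast fun a => by cases f a <;> rfl

theorem bool_beq {f g : A → Bool} (hf : PolyC f) (hg : PolyC g) : PolyC fun a => f a == g a :=
  (hf.ite hg hg.not).cast fun a => by cases f a <;> cases g a <;> rfl

/-! #### Lists -/

theorem cons {f : A → B} {g : A → List B} (hf : PolyC f) (hg : PolyC g) :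
    PolyC fun a => f a :: g a :=
  (hf.pair hg).cast fun _ => rfl

theorem map_expr {f : A → B} {g : A → C} (h : PolyC f) (E : Expr → Expr) (c : ℕ)
    (hsz : ∀ a, sz (g a) ≤ sz (f a) + c)
    (hE : ∀ P x e a t, EvalsIn P x e (enc (f a)) t → EvalsIn P x (E e) (enc (g a)) (t + c)) :
    PolyC g := by
  obtain ⟨h, T, hT, hf⟩ := h
  exact ⟨(h.add (.const _ c)).of_le hsz, _, hT.add (.const _ c), hf.map_expr E c hE⟩

theorem tail {f : A → List B} (hf : PolyC f) : PolyC fun a => (f a).tail := by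
  refine hf.map_expr .tl 1 (fun a => ?_) fun P x e a t h => ?_
  · cases f a <;> simp; omega
  · have := h.tl
    cases h' : f a <;> simpa [h', Data.tl] using this

theorem isEmpty {f : A → List B} (hf : PolyC f) : PolyC fun a => (f a).isEmpty := by
  refine hf.map_expr (fun e => .ite e .nil (.cons .nil .nil)) 4
    (fun a => (sz_bool_le _).trans (by omega)) fun P x e a t h => ?_
  cases h' : f a with
  | nil => rw [h'] at h; exact (h.ite_nil (.cons .nil .nil)).mono (by omega)
  | cons b l => rw [h'] at h; exact (h.ite_cons .nil).mono (by omega)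

/-- The head of `nil` is `nil` and not the code of the default, hence the test for emptiness. -/
theorem headD {f : A → List B} (hf : PolyC f) (b : B) : PolyC fun a => (f a).headD b := by
  have h : PolyC fun a => (enc (f a)).hd := by
    refine hf.map_expr .hd 1 (fun a => ?_) fun P x e a t h => h.hd
    cases f a
    · exact Nat.zero_le _
    · rename_i b l
      change (enc b).size ≤ (Data.cons (enc b) (enc l)).size + 1
      simp only [Data.size]
      omega
  refine (hf.isEmpty.ite (const (enc b)) h).cast fun a => ?_
  cases f a <;> rfl

theorem drop {f : A → List B} (hf : PolyC f) (k : ℕ) : PolyC fun a => (f a).drop k := by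
  induction k with
  | zero => exact hf
  | succ k ih => exact ih.tail.cast fun a => by simp

theorem foldr_add {f : A → B → C → C} {i : A → C} {l : A → List B} (hl : PolyC l) (hi : PolyC i)
    (hf : PolyC fun p : A × B × C => f p.1 p.2.1 p.2.2) {D : A × B → ℕ}
    (hD : PolyB (sz (A := A × B)) D) (hfD : ∀ a b c, sz (f a b c) ≤ sz c + D (a, b)) :
    PolyC fun a => (l a).foldr (fun b c => f a b c) (i a) :=
  foldr_of_add hl hi hf hD hfD

theorem uncurry₃ {f : A → B → D} (hf : PolyC fun p : A × B => f p.1 p.2) :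
    PolyC fun p : A × B × C => f p.1 p.2.1 :=
  hf.comp₂ id.fst id.snd.fst

theorem map {l : A → List B} {f : A → B → C} (hf : PolyC fun p : A × B => f p.1 p.2)
    (hl : PolyC l) : PolyC fun a => (l a).map fun b => f a b := by
  refine (foldr_add hl (const []) (f := fun a b c => f a b :: c)
    (hf.uncurry₃.cons id.snd.snd) (hf.1.add (.const _ 1)) fun a b c => ?_).cast fun a => ?_
  · simp only [sz_cons]; omega
  · rw [List.map_eq_foldr]

theorem append {f g : A → List B} (hf : PolyC f) (hg : PolyC g) : PolyC fun a => f a ++ g a := by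
  refine (foldr_add hf hg (f := fun _ b c => b :: c) (id.snd.fst.cons id.snd.snd)
    ((id.snd.1).add (.const _ 1)) fun a b c => ?_).cast fun a => ?_
  · simp only [sz_cons]; omega
  · rw [List.foldr_cons_eq_append']

theorem flatMap {l : A → List B} {f : A → B → List C} (hf : PolyC fun p : A × B => f p.1 p.2)
    (hl : PolyC l) : PolyC fun a => (l a).flatMap fun b => f a b := by
  refine (foldr_add hl (const []) (f := fun a b c => f a b ++ c)
    (hf.uncurry₃.append id.snd.snd) hf.1 fun a b c => ?_).cast fun a => ?_
  · simp only [sz_append]; omega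
  · congr 1
    induction l a with
    | nil => rfl
    | cons b l ih => simp [ih]

theorem filter {l : A → List B} {f : A → B → Bool} (hf : PolyC fun p : A × B => f p.1 p.2)
    (hl : PolyC l) : PolyC fun a => (l a).filter fun b => f a b := by
  refine (flatMap (f := fun a b => if f a b then [b] else [])
    (hf.ite (id.snd.cons (const [])) (const [])) hl).cast fun a => ?_
  congr 1
  induction l a with
  | nil => rfl
  | cons b l ih => by_cases h : f a b <;> simp [h, ih]

theorem any {l : A → List B} {f : A → B → Bool} (hf : PolyC fun p : A × B => f p.1 p.2)
    (hl : PolyC l) : PolyC fun a => (l a).any fun b => f a b := by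
  refine (filter hf hl).isEmpty.not.cast fun a => ?_
  congr 1
  induction l a with
  | nil => rfl
  | cons b l ih => by_cases h : f a b <;> simp_all

theorem all {l : A → List B} {f : A → B → Bool} (hf : PolyC fun p : A × B => f p.1 p.2)
    (hl : PolyC l) : PolyC fun a => (l a).all fun b => f a b :=
  (any hf.not hl).not.cast fun a => by rw [List.all_eq_not_any_not]

/-! #### Natural numbers -/

/-- A number in unary is a list of empty trees. -/
theorem enc_replicate (n : ℕ) : enc (List.replicate n Data.nil) = enc n := by
  induction n with
  | zero => rfl
  | succ n ih => rw [List.replicate_succ, enc_list_cons, ih]; rfl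

theorem unary {f : A → ℕ} (hf : PolyC f) : PolyC fun a => List.replicate (f a) Data.nil :=
  hf.cast fun _ => enc_replicate _

theorem succ {f : A → ℕ} (hf : PolyC f) : PolyC fun a => f a + 1 :=
  (cons (const Data.nil) hf.unary).cast fun a =>
    show enc (f a + 1) = enc (List.replicate (f a + 1) Data.nil) from (enc_replicate _).symm

theorem sub_const {f : A → ℕ} (hf : PolyC f) (k : ℕ) : PolyC fun a => f a - k :=
  (hf.unary.drop k).cast fun a => by simp [enc_replicate]

theorem nat_isZero {f : A → ℕ} (hf : PolyC f) : PolyC fun a => f a == 0 :=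
  hf.unary.isEmpty.cast fun a => by cases f a <;> simp

theorem foldr_replicate {α β : Type} (n : ℕ) (a : α) (f : β → β) (b : β) :
    (List.replicate n a).foldr (fun _ c => f c) b = f^[n] b := by
  induction n with
  | zero => rfl
  | succ n ih => simp [List.replicate_succ, ih, Function.iterate_succ_apply']

theorem iterate {n : A → ℕ} {i : A → C} {f : C → C} (hn : PolyC n) (hi : PolyC i) (hf : PolyC f)
    {k : ℕ} (hk : ∀ c, sz (f c) ≤ sz c + k) : PolyC fun a => f^[n a] (i a) :=
  (foldr_add hn.unary hi (f := fun _ _ c => f c) (hf.comp id.snd.snd) (.const _ k)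
    fun _ _ c => hk c).cast fun a => by rw [foldr_replicate]

theorem nat_add {f g : A → ℕ} (hf : PolyC f) (hg : PolyC g) : PolyC fun a => f a + g a :=
  (iterate hg hf (f := fun n => n + 1) id.succ (k := 1) fun n => by simp).cast fun a => by
    congr 1
    induction g a with
    | zero => rfl
    | succ n ih => rw [Function.iterate_succ_apply', ← ih]; omega

theorem drop_nat {f : A → List B} {g : A → ℕ} (hf : PolyC f) (hg : PolyC g) :
    PolyC fun a => (f a).drop (g a) :=
  (iterate hg hf (f := fun l => l.tail) id.tail (k := 0)
    fun l => sz_le_of_suffix (List.tail_suffix l)).cast fun a => by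
    congr 1
    induction g a with
    | zero => rfl
    | succ n ih => rw [Function.iterate_succ_apply', ← ih, List.tail_drop]

/-- In unary, truncated subtraction is dropping entries of a list. -/
theorem nat_sub {f g : A → ℕ} (hf : PolyC f) (hg : PolyC g) : PolyC fun a => f a - g a :=
  (hf.unary.drop_nat hg).cast fun a => by simp [enc_replicate]

/-- Trees cannot be compared in one step; equality is the vanishing of both truncated differences.
-/
theorem nat_beq {f g : A → ℕ} (hf : PolyC f) (hg : PolyC g) : PolyC fun a => f a == g a :=
  ((hf.nat_sub hg).nat_isZero.and (hg.nat_sub hf).nat_isZero).cast fun a => by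
    congr 1
    rw [Bool.eq_iff_iff]
    simp
    omega

theorem fin_val {k : ℕ} {f : A → Fin k} (hf : PolyC f) : PolyC fun a => (f a : ℕ) :=
  hf.cast fun _ => rfl

theorem fin_beq {k : ℕ} {f g : A → Fin k} (hf : PolyC f) (hg : PolyC g) :
    PolyC fun a => f a == g a :=
  (hf.fin_val.nat_beq hg.fin_val).cast fun a => by
    congr 1
    rw [Bool.eq_iff_iff]
    simp [Fin.ext_iff]

theorem fin_succ {f : A → Fin 3} (hf : PolyC f) : PolyC fun a => f a + 1 :=
  ((hf.fin_beq (const 0)).ite (const (1 : Fin 3))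
    ((hf.fin_beq (const 1)).ite (const (2 : Fin 3)) (const (0 : Fin 3)))).cast fun a => by
    generalize f a = x
    fin_cases x <;> rfl

/-- Recursion over a list with a counter, which collects the lists `g a b m` for the values `m` of
the counter. -/
theorem foldr_counter {l : A → List B} {i : A → ℕ × List C} {g : A → B → ℕ → List C}
    (hl : PolyC l) (hi : PolyC i) (hg : PolyC fun p : A × B × ℕ => g p.1 p.2.1 p.2.2) :
    PolyC fun a => (l a).foldr (fun b t => (t.1 + 1, g a b t.1 ++ t.2)) (i a) := by
  have hf : PolyC fun p : A × B × ℕ × List C =>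
      (p.2.2.1 + 1, g p.1 p.2.1 p.2.2.1 ++ p.2.2.2) :=
    id.snd.snd.fst.succ.pair ((hg.comp (id.fst.pair (id.snd.fst.pair id.snd.snd.fst))).append
      id.snd.snd.snd)
  obtain ⟨k, hk⟩ := hg.1
  let M : A → ℕ := fun a => (sz a + 2 * sz (l a) + sz (i a) + 4) ^ k
  have hM : PolyB (sz (A := A)) M :=
    ((((PolyB.refl _).add ((PolyB.const _ 2).mul hl.1)).add hi.1).add (.const _ 4)).pow k
  refine foldr hl hi hf (S := fun a => sz (i a) + sz (l a) * (M a + 1))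
    (hi.1.add (hl.1.mul (hM.add (.const _ 1)))) fun a l' h => ?_
  -- The growth per step depends on the counter, so `foldr_of_add` does not apply. Instead the
  -- counter is tracked exactly, which bounds the argument of `g` in every step.
  have key : (l'.foldr (fun b t => (t.1 + 1, g a b t.1 ++ t.2)) (i a)).1 = (i a).1 + l'.length ∧
      sz (l'.foldr (fun b t => (t.1 + 1, g a b t.1 ++ t.2)) (i a)) ≤
        sz (i a) + l'.length * (M a + 1) := by
    induction l' with
    | nil => simp
    | cons b l' ih =>
      have h' : l' <:+ l a := (List.suffix_cons b l').trans h
      obtain ⟨ih₁, ih₂⟩ := ih h'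
      set t := l'.foldr (fun b t => (t.1 + 1, g a b t.1 ++ t.2)) (i a)
      have hM : sz (g a b t.1) ≤ M a := by
        refine (hk (a, b, t.1)).trans (Nat.pow_le_pow_left ?_ k)
        have h₂ : sz b ≤ sz (l a) := sz_le_of_mem (h.subset (by simp))
        have h₃ := (length_le_sz l').trans (sz_le_of_suffix h')
        have h₄ : (i a).1 ≤ sz (i a) := by
          change _ ≤ sz (i a).1 + sz (i a).2 + 1
          rw [sz_nat]
          omega
        simp only [sz_pair, sz_nat]
        omega
      have ht : sz t = t.1 + sz t.2 + 1 := by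
        change sz t.1 + sz t.2 + 1 = _
        rw [sz_nat]
      simp only [List.foldr_cons, List.length_cons, Nat.succ_mul, sz_pair, sz_append, sz_nat]
      change t.1 + 1 = _ ∧ _
      refine ⟨by omega, ?_⟩
      change t.1 + 1 + (sz (g a b t.1) + sz t.2) + 1 ≤ _
      omega
  have := Nat.mul_le_mul_right (M a + 1) ((length_le_sz l').trans (sz_le_of_suffix h))
  exact key.2.trans (by omega)

end PolyC

/-! ### The reduction to a CSP formula -/

/-- A literal, with its variable as a natural number. -/
abbrev RawLiteral : Type := ℕ × Bool

/-- A constraint as a list. -/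
abbrev RawConstraint : Type := List (ℕ × Fin 3)

/-- An entry `(x, i, j)` says that `x` is the `j`-th variable of the `i`-th false clause. -/
abbrev TableEntry : Type := ℕ × ℕ × Fin 3

/-- Whether a literal is true. -/
def litTrue (α : List Bool) (l : RawLiteral) : Bool := (α.drop l.1).headD false == l.2

/-- The list of the false clauses. -/
def negClauses (α : List Bool) (L : List (List RawLiteral)) : List (List RawLiteral) :=
  L.filter fun C => C.all fun l => !litTrue α l

/-- The `j`-th variable of a clause. -/
def clauseVar (C : List RawLiteral) (j : ℕ) : ℕ := ((C.drop j).headD (0, false)).1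

/-- The number of the clauses, and the table of their variables. The clauses are numbered from the
end of the list. -/
def varTable (N : List (List RawLiteral)) : ℕ × List TableEntry :=
  N.foldr (fun C t => (t.1 + 1,
    [(clauseVar C 0, t.1, 0), (clauseVar C 1, t.1, 1), (clauseVar C 2, t.1, 2)] ++ t.2)) (0, [])

/-- The constraints that say that the literal `l` is true after exactly one variable of each
false clause has been flipped. -/
def litConstraints (α : List Bool) (tab : List TableEntry) (l : RawLiteral) :
    List RawConstraint :=
  if litTrue α l then (tab.filter fun e => e.1 == l.1).map fun e => [e.2]
  -- A variable outside the table is never flipped, so the literal remains false; the empty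
  -- constraint is unsatisfiable.
  else if (tab.filter fun e => e.1 == l.1).isEmpty then [[]]
  else [[((((tab.filter fun e => e.1 == l.1).headD (0, 0, 0)).2.1),
      ((tab.filter fun e => e.1 == l.1).headD (0, 0, 0)).2.2 + 1)],
    [((((tab.filter fun e => e.1 == l.1).headD (0, 0, 0)).2.1),
      ((tab.filter fun e => e.1 == l.1).headD (0, 0, 0)).2.2 + 1 + 1)]]

/-- The disjunction of two conjunctions of constraints. -/
def disj (X Y : List RawConstraint) : List RawConstraint :=
  X.flatMap fun c => Y.map fun d => c ++ d

/-- The constraints of the first literal of `C`, if there is one. -/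
def headConstraints (α : List Bool) (tab : List TableEntry) (C : List RawLiteral) :
    List RawConstraint :=
  if C.isEmpty then [[]] else litConstraints α tab (C.headD (0, false))

/-- The constraints for a clause with at most three literals. -/
def clauseConstraints (α : List Bool) (tab : List TableEntry) (C : List RawLiteral) :
    List RawConstraint :=
  disj (headConstraints α tab C)
    (disj (headConstraints α tab (C.drop 1)) (headConstraints α tab (C.drop 2)))

/-- The reduction of an instance to a CSP formula, given by its number of variables and the list of
its constraints. -/
def reduction (I : ℕ × ℕ × List Bool × List (List RawLiteral)) : ℕ × List RawConstraint :=
  (I.2.1, I.2.2.2.flatMap fun C =>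
    clauseConstraints I.2.2.1 (varTable (negClauses I.2.2.1 I.2.2.2)).2 C)

namespace PolyC

variable {A : Type} [Enc A]

theorem litTrue : PolyC fun p : List Bool × RawLiteral => litTrue p.1 p.2 :=
  ((id.fst.drop_nat id.snd.fst).headD false).bool_beq id.snd.snd

theorem negClauses : PolyC fun p : List Bool × List (List RawLiteral) => negClauses p.1 p.2 :=
  filter (all (litTrue.comp (id.fst.fst.fst.pair id.snd)).not id.snd) id.snd

theorem clauseVar (j : ℕ) : PolyC fun C : List RawLiteral => clauseVar C j :=
  ((id.drop j).headD (0, false)).fst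

theorem varTable : PolyC fun N : List (List RawLiteral) => varTable N := by
  have h (j : Fin 3) : PolyC fun p : List (List RawLiteral) × List RawLiteral × ℕ =>
      (BallSat.clauseVar p.2.1 j, p.2.2, j) :=
    ((clauseVar j).comp id.snd.fst).pair (id.snd.snd.pair (const j))
  exact foldr_counter (g := fun _ C m => [(_, m, 0), (_, m, 1), (_, m, 2)]) id (const (0, []))
    ((h 0).cons ((h 1).cons ((h 2).cons (const []))))

theorem litConstraints : PolyC fun p : List Bool × List TableEntry × RawLiteral =>
    litConstraints p.1 p.2.1 p.2.2 := by
  have hm : PolyC fun p : List Bool × List TableEntry × RawLiteral =>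
      p.2.1.filter fun e => e.1 == p.2.2.1 :=
    filter (f := fun (p : List Bool × List TableEntry × RawLiteral) (e : TableEntry) =>
      e.1 == p.2.2.1) (id.snd.fst.nat_beq id.fst.snd.snd.fst) id.snd.fst
  have he := hm.headD (0, 0, 0)
  refine (litTrue.comp (id.fst.pair id.snd.snd)).ite
    (map (f := fun _ e => [e.2]) (id.snd.snd.cons (const [])) hm)
    (hm.isEmpty.ite (const [[]]) (cons (cons (he.snd.fst.pair he.snd.snd.fin_succ) (const []))
      (cons (cons (he.snd.fst.pair he.snd.snd.fin_succ.fin_succ) (const [])) (const []))))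

theorem disj {f g : A → List RawConstraint} (hf : PolyC f) (hg : PolyC g) :
    PolyC fun a => disj (f a) (g a) :=
  flatMap (f := fun a c => (g a).map fun d => c ++ d)
    (map (f := fun (p : A × RawConstraint) d => p.2 ++ d) (id.fst.snd.append id.snd)
      (hg.comp id.fst)) hf

theorem headConstraints : PolyC fun p : List Bool × List TableEntry × List RawLiteral =>
    headConstraints p.1 p.2.1 p.2.2 :=
  id.snd.snd.isEmpty.ite (const [[]])
    (litConstraints.comp (id.fst.pair (id.snd.fst.pair (id.snd.snd.headD (0, false)))))

theorem clauseConstraints : PolyC fun p : List Bool × List TableEntry × List RawLiteral =>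
    clauseConstraints p.1 p.2.1 p.2.2 :=
  headConstraints.disj
    ((headConstraints.comp (id.fst.pair (id.snd.fst.pair (id.snd.snd.drop 1)))).disj
      (headConstraints.comp (id.fst.pair (id.snd.fst.pair (id.snd.snd.drop 2)))))

theorem reduction : PolyC fun I => reduction I := by
  have ht : PolyC fun I : ℕ × ℕ × List Bool × List (List RawLiteral) =>
      (BallSat.varTable (BallSat.negClauses I.2.2.1 I.2.2.2)).2 :=
    (varTable.comp (negClauses.comp (id.snd.snd.fst.pair id.snd.snd.snd))).snd
  exact id.snd.fst.pair (flatMap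
    (clauseConstraints.comp (id.fst.snd.snd.fst.pair ((ht.comp id.fst).pair id.snd)))
    id.snd.snd.snd)

end PolyC

/-! ### Correctness of the reduction -/

/-- The assignment `A` satisfies all constraints in the list `X`. -/
def SatisfiesAll (A : ℕ → Fin 3) (X : List RawConstraint) : Prop :=
  ∀ c ∈ X, ∃ p ∈ c, A p.1 ≠ p.2

/-- The variable `x` is one of those that `A` selects from the false clauses. -/
def Selects (tab : List TableEntry) (A : ℕ → Fin 3) (x : ℕ) : Prop :=
  ∃ e ∈ tab, e.1 = x ∧ A e.2.1 = e.2.2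

/-- Distributivity: if `c` fails in `X` and `d` fails in `Y`, then `c ++ d` fails in `disj X Y`. -/
theorem satisfiesAll_disj (A : ℕ → Fin 3) (X Y : List RawConstraint) :
    SatisfiesAll A (disj X Y) ↔ SatisfiesAll A X ∨ SatisfiesAll A Y := by
  constructor
  · intro h
    by_contra! hXY
    obtain ⟨hX, hY⟩ := hXY
    simp only [SatisfiesAll, not_forall] at hX hY
    obtain ⟨c, hc, hc'⟩ := hX
    obtain ⟨d, hd, hd'⟩ := hY
    obtain ⟨p, hp, hAp⟩ := h (c ++ d)
      (List.mem_flatMap.2 ⟨c, hc, List.mem_map.2 ⟨d, hd, rfl⟩⟩)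
    rcases List.mem_append.1 hp with hp | hp
    · exact hc' ⟨p, hp, hAp⟩
    · exact hd' ⟨p, hp, hAp⟩
  · intro h e he
    obtain ⟨c, hc, he⟩ := List.mem_flatMap.1 he
    obtain ⟨d, hd, rfl⟩ := List.mem_map.1 he
    rcases h with h | h
    · obtain ⟨p, hp, hAp⟩ := h c hc
      exact ⟨p, by simp [hp], hAp⟩
    · obtain ⟨p, hp, hAp⟩ := h d hd
      exact ⟨p, by simp [hp], hAp⟩

/-- A missing literal counts as false, which is neutral for the disjunction; so clauses with fewer
than three literals need no separate treatment. -/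
theorem satisfiesAll_headConstraints_nil (A : ℕ → Fin 3) (α : List Bool)
    (tab : List TableEntry) : ¬ SatisfiesAll A (headConstraints α tab []) := by
  intro h
  obtain ⟨p, hp, -⟩ := h [] (by simp [headConstraints])
  simp at hp

theorem headConstraints_cons (α : List Bool) (tab : List TableEntry) (l : RawLiteral)
    (C : List RawLiteral) : headConstraints α tab (l :: C) = litConstraints α tab l := rfl

theorem satisfiesAll_clauseConstraints (A : ℕ → Fin 3) (α : List Bool) (tab : List TableEntry)
    {C : List RawLiteral} (hC : C.length ≤ 3) :
    SatisfiesAll A (clauseConstraints α tab C) ↔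
      ∃ l ∈ C, SatisfiesAll A (litConstraints α tab l) := by
  rw [clauseConstraints, satisfiesAll_disj, satisfiesAll_disj]
  match C, hC with
  | [], _ => simp [satisfiesAll_headConstraints_nil]
  | [a], _ => simp [satisfiesAll_headConstraints_nil, headConstraints_cons]
  | [a, b], _ => simp [satisfiesAll_headConstraints_nil, headConstraints_cons]
  | [a, b, c], _ => simp [headConstraints_cons]
  | _ :: _ :: _ :: _ :: _, h => simp at h; omega

/-- Expresses an equation by the only literals a CSP formula has. -/
theorem fin_three_eq_iff (a b : Fin 3) : a = b ↔ a ≠ b + 1 ∧ a ≠ b + 1 + 1 := by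
  revert a b; decide

/-- For a false literal, `htab` makes the head of the filtered table its only entry, so that being
selected is a single equation `A i = j`. -/
theorem satisfiesAll_litConstraints (A : ℕ → Fin 3) (α : List Bool) {tab : List TableEntry}
    (htab : ∀ e ∈ tab, ∀ e' ∈ tab, e.1 = e'.1 → e = e') (l : RawLiteral) :
    SatisfiesAll A (litConstraints α tab l) ↔ (litTrue α l = true ↔ ¬ Selects tab A l.1) := by
  have hmem (e) : e ∈ tab.filter (fun e => e.1 == l.1) ↔ e ∈ tab ∧ e.1 = l.1 := by simp
  unfold litConstraints
  generalize tab.filter (fun e => e.1 == l.1) = m at *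
  by_cases hl : litTrue α l = true
  · simp only [hl, if_true, SatisfiesAll, List.mem_map, Selects, true_iff]
    constructor
    · rintro h ⟨e, he, hel, hA⟩
      obtain ⟨p, hp, hAp⟩ := h [e.2] ⟨e, (hmem e).2 ⟨he, hel⟩, rfl⟩
      obtain rfl := List.mem_singleton.1 hp
      exact hAp hA
    · rintro h c ⟨e, he, rfl⟩
      have he := (hmem e).1 he
      exact ⟨e.2, by simp, fun hA => h ⟨e, he.1, he.2, hA⟩⟩
  · cases m with
    | nil =>
      have : ¬ Selects tab A l.1 := by
        rintro ⟨e, he, hel, -⟩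
        simpa using (hmem e).2 ⟨he, hel⟩
      simp [hl, SatisfiesAll, this]
    | cons e m =>
      have he := (hmem e).1 (by simp)
      have hS : Selects tab A l.1 ↔ A e.2.1 = e.2.2 := by
        constructor
        · rintro ⟨e', he', hel, hA⟩
          obtain rfl := htab e he.1 e' he' (he.2.trans hel.symm)
          exact hA
        · intro hA
          exact ⟨e, he.1, he.2, hA⟩
      simp only [hl, hS, fin_three_eq_iff]
      simp [SatisfiesAll]

theorem varTable_fst (N : List (List RawLiteral)) : (varTable N).1 = N.length := by
  induction N with
  | nil => rfl
  | cons C N ih =>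
    change (varTable N).1 + 1 = _
    rw [ih, List.length_cons]

/-- The reversal comes from the right fold, which gives number 0 to the last clause. -/
theorem mem_varTable (N : List (List RawLiteral)) (x i : ℕ) (j : Fin 3) :
    (x, i, j) ∈ (varTable N).2 ↔ ∃ h : i < N.reverse.length, x = clauseVar N.reverse[i] j := by
  induction N with
  | nil => simp [varTable]
  | cons C N ih =>
    have : (varTable (C :: N)).2 = [(clauseVar C 0, (varTable N).1, 0),
      (clauseVar C 1, (varTable N).1, 1), (clauseVar C 2, (varTable N).1, 2)] ++
        (varTable N).2 := rfl
    rw [this, List.mem_append, ih, varTable_fst]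
    have h₁ : (x, i, j) ∈ [(clauseVar C 0, N.length, (0 : Fin 3)),
        (clauseVar C 1, N.length, 1), (clauseVar C 2, N.length, 2)] ↔
        i = N.length ∧ x = clauseVar C j := by
      fin_cases j <;> simp [and_comm]
    rw [h₁]
    simp only [List.reverse_cons, List.length_append, List.length_reverse, List.length_singleton]
    constructor
    · rintro (⟨rfl, rfl⟩ | ⟨h, rfl⟩)
      · exact ⟨by omega, by simp⟩
      · exact ⟨by omega, by rw [List.getElem_append_left]⟩
    · rintro ⟨h, rfl⟩
      by_cases hi : i = N.length
      · subst hi; left; simp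
      · right
        have hi : i < N.reverse.length := by simp; omega
        exact ⟨by simpa using hi, by rw [List.getElem_append_left hi]⟩

/-! #### Validity of the constraints -/

/-- The constraint has at most `k` literals, and its variables are below `r`. -/
def Valid (k r : ℕ) (c : RawConstraint) : Prop := c.length ≤ k ∧ ∀ p ∈ c, p.1 < r

theorem valid_disj {k l r : ℕ} {X Y : List RawConstraint} (hX : ∀ c ∈ X, Valid k r c)
    (hY : ∀ c ∈ Y, Valid l r c) : ∀ c ∈ disj X Y, Valid (k + l) r c := by
  intro e he
  obtain ⟨c, hc, he⟩ := List.mem_flatMap.1 he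
  obtain ⟨d, hd, rfl⟩ := List.mem_map.1 he
  obtain ⟨h₁, h₂⟩ := hX c hc
  obtain ⟨h₃, h₄⟩ := hY d hd
  refine ⟨by simp; omega, fun p hp => ?_⟩
  rcases List.mem_append.1 hp with hp | hp
  · exact h₂ p hp
  · exact h₄ p hp

theorem valid_litConstraints {r : ℕ} (α : List Bool) {tab : List TableEntry}
    (htab : ∀ e ∈ tab, e.2.1 < r) (l : RawLiteral) :
    ∀ c ∈ litConstraints α tab l, Valid 1 r c := by
  have hmem (e) : e ∈ tab.filter (fun e => e.1 == l.1) → e.2.1 < r := fun h =>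
    htab e (List.mem_filter.1 h).1
  unfold litConstraints
  generalize tab.filter (fun e => e.1 == l.1) = m at *
  split
  · simp only [List.mem_map]
    rintro c ⟨e, he, rfl⟩
    exact ⟨by simp, by simpa using hmem e he⟩
  · cases m with
    | nil => simp [Valid]
    | cons e m => simp [Valid, hmem e]

theorem valid_headConstraints {r : ℕ} (α : List Bool) {tab : List TableEntry}
    (htab : ∀ e ∈ tab, e.2.1 < r) (C : List RawLiteral) :
    ∀ c ∈ headConstraints α tab C, Valid 1 r c := by
  cases C with
  | nil => simp [headConstraints, Valid]
  | cons l C => exact valid_litConstraints α htab l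

/-- Each of the three conjunctions in a clause has constraints of at most one literal, and widths
add under `disj`. The variables are numbers of false clauses, of which there are `r`. -/
theorem valid_reduction (I : ℕ × ℕ × List Bool × List (List RawLiteral))
    (hI : (negClauses I.2.2.1 I.2.2.2).length = I.2.1) :
    ∀ c ∈ (reduction I).2, Valid 3 I.2.1 c := by
  intro c hc
  have htab : ∀ e ∈ (varTable (negClauses I.2.2.1 I.2.2.2)).2, e.2.1 < I.2.1 := by
    rintro ⟨x, i, j⟩ he
    obtain ⟨h, -⟩ := (mem_varTable _ _ _ _).1 he
    simpa [hI] using h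
  obtain ⟨C, -, hc⟩ := List.mem_flatMap.1 hc
  exact valid_disj (valid_headConstraints _ htab _)
    (valid_disj (valid_headConstraints _ htab _) (valid_headConstraints _ htab _)) c hc

/-! #### Instances as raw data -/

section Instances

variable {n : ℕ}

/-- A literal as raw data. -/
def Literal.raw (l : Literal n) : RawLiteral := (l.1, l.2)

/-- An instance as raw data. -/
def rawInstance (n : ℕ) (L : List (List (Literal n))) (α : Assignment n) (r : ℕ) :
    ℕ × ℕ × List Bool × List (List RawLiteral) :=
  (n, r, List.ofFn α, L.map (List.map Literal.raw))

theorem encList_map {β γ : Type} (e : γ → Data) (g : β → γ) (l : List β) :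
    encList e (l.map g) = encList (fun b => e (g b)) l := by
  induction l with
  | nil => rfl
  | cons b l ih => simp [encList, ih]

theorem enc_rawInstance (n : ℕ) (L : List (List (Literal n))) (α : Assignment n) (r : ℕ) :
    enc (rawInstance n L α r) = encInstance n L α r := by
  change Data.cons _ (.cons _ (.cons _
    (encList (encList enc) (L.map (List.map Literal.raw))))) = _
  simp only [encList_map]
  rfl

theorem litTrue_raw (α : Assignment n) (l : Literal n) :
    litTrue (List.ofFn α) l.raw = true ↔ Literal.Holds α l := by
  simp [litTrue, Literal.raw, Literal.Holds, List.headD_eq_head?_getD, List.head?_drop]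

theorem mem_neg {α : Assignment n} {F : Formula n} {C : Clause n} :
    C ∈ Formula.neg α F ↔ C ∈ F ∧ ∀ l ∈ C, ¬ Literal.Holds α l := by
  simp [Formula.neg]

theorem mem_of_lists {L : List (List (Literal n))} {F : Formula n} (hL : Lists L F)
    {C : List (Literal n)} (hC : C ∈ L) : C.toFinset ∈ F := by
  rw [← hL, List.mem_toFinset]
  exact List.mem_map_of_mem hC

theorem Formula.holds_iff {L : List (List (Literal n))} {F : Formula n} (hL : Lists L F)
    (β : Assignment n) : F.Holds β ↔ ∀ C ∈ L, ∃ l ∈ C, Literal.Holds β l := by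
  rw [← hL]
  simp [Formula.Holds, Clause.Holds]

theorem clauseVar_raw (C : List (Literal n)) (j : ℕ) (hj : j < C.length) :
    clauseVar (C.map Literal.raw) j = C[j].1 := by
  simp [clauseVar, Literal.raw, List.headD_eq_head?_getD, List.head?_drop, hj]

/-- Here it matters that `L` has no repetitions: a false clause written twice would be numbered
twice, and there would be more than `r` numbers. -/
theorem exists_negClauses {F : Formula n} {α : Assignment n} {r : ℕ}
    (hN : F.NegDisjoint α r) {L : List (List (Literal n))} (hL : ListsOnce L F) :
    ∃ N : List (List (Literal n)), N.length = r ∧ (N.map List.toFinset).Nodup ∧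
      (∀ C ∈ N, C ∈ L ∧ C.toFinset ∈ Formula.neg α F) ∧
      negClauses (List.ofFn α) (L.map (List.map Literal.raw)) = N.map (List.map Literal.raw) := by
  refine ⟨L.filter fun C => C.all fun l => !litTrue (List.ofFn α) l.raw, ?_, ?_, ?_, ?_⟩
  rotate_left
  · exact hL.2.1.sublist (List.filter_sublist.map _)
  · intro C hC
    obtain ⟨hC, h⟩ := List.mem_filter.1 hC
    refine ⟨hC, mem_neg.2 ⟨mem_of_lists hL.1 hC, fun l hl => ?_⟩⟩
    rw [List.all_eq_true] at h
    have := h l (List.mem_toFinset.1 hl)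
    rw [← litTrue_raw]
    simpa using this
  · rw [negClauses, List.filter_map]
    congr 2
    funext C
    simp [Function.comp_def]
  · rw [← hN.1, ← List.length_map (f := List.toFinset),
      ← List.toFinset_card_of_nodup (hL.2.1.sublist (List.filter_sublist.map _))]
    congr 1
    ext C
    simp only [List.mem_toFinset, List.mem_map, List.mem_filter, List.all_eq_true, mem_neg]
    constructor
    · rintro ⟨D, ⟨hD, h⟩, rfl⟩
      refine ⟨mem_of_lists hL.1 hD, fun l hl => ?_⟩
      rw [← litTrue_raw]
      simpa using h l (List.mem_toFinset.1 hl)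
    · rintro ⟨hC, h⟩
      rw [← hL.1, List.mem_toFinset, List.mem_map] at hC
      obtain ⟨D, hD, rfl⟩ := hC
      refine ⟨D, ⟨hD, fun l hl => ?_⟩, rfl⟩
      have := h l (List.mem_toFinset.2 hl)
      rw [← litTrue_raw] at this
      simpa using this

/-- A literal and its negation are not both false, so the three literals of a false clause have
three different variables. -/
theorem fst_eq_of_mem_neg {α : Assignment n} {F : Formula n} {C : Clause n}
    (hC : C ∈ Formula.neg α F) {l l' : Literal n} (hl : l ∈ C) (hl' : l' ∈ C)
    (h : l.1 = l'.1) : l = l' := by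
  have h₁ := (mem_neg.1 hC).2 l hl
  have h₂ := (mem_neg.1 hC).2 l' hl'
  obtain ⟨x, b⟩ := l
  obtain ⟨y, c⟩ := l'
  obtain rfl : x = y := h
  simp only [Literal.Holds] at h₁ h₂
  congr 1
  revert h₁ h₂
  cases α x <;> cases b <;> cases c <;> simp

/-- The variables of the false clauses, and their table. -/
theorem exists_variables {F : Formula n} {α : Assignment n} {r : ℕ}
    (hN : F.NegDisjoint α r) {L : List (List (Literal n))} (hL : ListsOnce L F) :
    (negClauses (List.ofFn α) (L.map (List.map Literal.raw))).length = r ∧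
    ∃ X : Fin r → Fin 3 → Fin n,
      (∀ i j i' j', X i j = X i' j' → i = i' ∧ j = j') ∧
      (∀ i, ∃ C ∈ F, ∀ l ∈ C, (∃ j, l.1 = X i j) ∧ ¬ Literal.Holds α l) ∧
      ∀ x i j, (x, i, j) ∈
          (varTable (negClauses (List.ofFn α) (L.map (List.map Literal.raw)))).2 ↔
        ∃ h : i < r, x = X ⟨i, h⟩ j := by
  obtain ⟨N, hr, hnodup, hmem, hraw⟩ := exists_negClauses hN hL
  have hlen (i : Fin r) : (i : ℕ) < N.reverse.length := by simp [hr]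
  have hM (i : Fin r) := hmem (N.reverse[(i : ℕ)]'(hlen i)) (by
    rw [← List.mem_reverse]; exact List.getElem_mem _)
  have h3 (i : Fin r) : (N.reverse[(i : ℕ)]'(hlen i)).length = 3 := by
    rw [← List.toFinset_card_of_nodup (hL.2.2 _ (hM i).1)]
    exact hN.2.1 _ (hM i).2
  let X : Fin r → Fin 3 → Fin n := fun i j =>
    ((N.reverse[(i : ℕ)]'(hlen i))[(j : ℕ)]'(by rw [h3]; exact j.2)).1
  refine ⟨by rw [hraw, List.length_map, hr], X, ?_, ?_, ?_⟩
  · intro i j i' j' h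
    have hl := List.mem_toFinset.2 (List.getElem_mem (l := N.reverse[(i : ℕ)]'(hlen i))
      (n := j) (by rw [h3]; exact j.2))
    have hl' := List.mem_toFinset.2 (List.getElem_mem (l := N.reverse[(i' : ℕ)]'(hlen i'))
      (n := j') (by rw [h3]; exact j'.2))
    obtain rfl : i = i' := by
      by_contra hne
      have hne' : (N.reverse[(i : ℕ)]'(hlen i)).toFinset ≠
          (N.reverse[(i' : ℕ)]'(hlen i')).toFinset := by
        intro heq
        have hnd : (N.reverse.map List.toFinset).Nodup := by
          rw [List.map_reverse, List.nodup_reverse]; exact hnodup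
        have := (hnd.getElem_inj_iff (i := i) (j := i') (hi := by simpa using hlen i)
          (hj := by simpa using hlen i')).1 (by simpa using heq)
        exact hne (Fin.ext this)
      refine Finset.disjoint_left.1 (hN.2.2 _ (hM i).2 _ (hM i').2 hne')
        (Finset.mem_image_of_mem _ hl) ?_
      change X i j ∈ _
      rw [h]
      exact Finset.mem_image_of_mem _ hl'
    refine ⟨rfl, ?_⟩
    have := fst_eq_of_mem_neg (hM i).2 hl hl' h
    exact Fin.ext (((hL.2.2 _ (hM i).1).getElem_inj_iff).1 this)
  · intro i
    refine ⟨_, (mem_neg.1 (hM i).2).1, fun l hl => ⟨?_, (mem_neg.1 (hM i).2).2 l hl⟩⟩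
    obtain ⟨j, hj, rfl⟩ := List.mem_iff_getElem.1 (List.mem_toFinset.1 hl)
    exact ⟨⟨j, by rw [← h3 i]; exact hj⟩, rfl⟩
  · intro x i j
    rw [hraw, mem_varTable]
    have hget (hi : i < r) (h) : (N.map (List.map Literal.raw)).reverse[i]'h =
        (N.reverse[i]'(hlen ⟨i, hi⟩)).map Literal.raw := by simp
    constructor
    · rintro ⟨h, rfl⟩
      have hi : i < r := by simpa [hr] using h
      refine ⟨hi, ?_⟩
      have := clauseVar_raw (N.reverse[i]'(hlen ⟨i, hi⟩)) j (by rw [h3 ⟨i, hi⟩]; exact j.2)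
      rw [hget hi]
      exact this
    · rintro ⟨hi, rfl⟩
      refine ⟨by simpa [hr] using hi, ?_⟩
      have := clauseVar_raw (N.reverse[i]'(hlen ⟨i, hi⟩)) j (by rw [h3 ⟨i, hi⟩]; exact j.2)
      rw [hget hi]
      exact this.symm

open Classical in
/-- The assignment obtained from `α` by flipping the selected variables. -/
noncomputable def flipSelected (α : Assignment n) (tab : List TableEntry) (A : ℕ → Fin 3) :
    Assignment n :=
  fun x => if Selects tab A x then !α x else α x

theorem holds_flipSelected (α : Assignment n) (tab : List TableEntry) (A : ℕ → Fin 3)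
    (l : Literal n) :
    Literal.Holds (flipSelected α tab A) l ↔
      (litTrue (List.ofFn α) l.raw = true ↔ ¬ Selects tab A l.raw.1) := by
  rw [litTrue_raw]
  change _ ↔ (_ ↔ ¬ Selects tab A l.1)
  simp only [Literal.Holds, flipSelected]
  split
  · cases α l.1 <;> cases l.2 <;> simp [*]
  · cases α l.1 <;> cases l.2 <;> simp [*]

theorem satisfiable_reduction_iff {F : Formula n} {α : Assignment n} {r : ℕ} (hF : F.IsCNF 3)
    (hN : F.NegDisjoint α r) {L : List (List (Literal n))} (hL : ListsOnce L F) :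
    (∃ A, SatisfiesAll A (reduction (rawInstance n L α r)).2) ↔ InBall F α r := by
  obtain ⟨-, X, hX, hXF, htab⟩ := exists_variables hN hL
  set tab := (varTable (negClauses (List.ofFn α) (L.map (List.map Literal.raw)))).2 with htab_def
  have huniq : ∀ e ∈ tab, ∀ e' ∈ tab, e.1 = e'.1 → e = e' := by
    rintro ⟨x, i, j⟩ he ⟨y, i', j'⟩ he' hxy
    obtain ⟨hi, rfl⟩ := (htab _ _ _).1 he
    obtain ⟨hi', rfl⟩ := (htab _ _ _).1 he'
    have := hX _ _ _ _ (Fin.ext hxy)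
    simp only [Fin.mk.injEq] at this
    obtain ⟨rfl, rfl⟩ := this
    rfl
  have hsel (A : ℕ → Fin 3) (x : Fin n) : Selects tab A x ↔ ∃ i : Fin r, x = X i (A i) := by
    constructor
    · rintro ⟨⟨_, i, j⟩, he, rfl, hj⟩
      obtain rfl : A i = j := hj
      obtain ⟨hi, h⟩ := (htab _ _ _).1 he
      exact ⟨⟨i, hi⟩, Fin.ext h⟩
    · rintro ⟨i, rfl⟩
      exact ⟨(X i (A i), i, A i), (htab _ _ _).2 ⟨i.2, rfl⟩, rfl, rfl⟩
  have hsat (A : ℕ → Fin 3) : SatisfiesAll A (reduction (rawInstance n L α r)).2 ↔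
      F.Holds (flipSelected α tab A) := by
    rw [Formula.holds_iff hL.1]
    have : SatisfiesAll A (reduction (rawInstance n L α r)).2 ↔
        ∀ C ∈ L, SatisfiesAll A
          (clauseConstraints (List.ofFn α) tab (C.map Literal.raw)) := by
      simp only [SatisfiesAll, reduction, rawInstance, List.mem_flatMap, List.mem_map]
      constructor
      · intro h C hC c hc
        exact h c ⟨_, ⟨C, hC, rfl⟩, hc⟩
      · rintro h c ⟨_, ⟨C, hC, rfl⟩, hc⟩
        exact h C hC c hc
    rw [this]
    refine forall₂_congr fun C hC => ?_
    have hlen : (C.map Literal.raw).length ≤ 3 := by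
      rw [List.length_map, ← List.toFinset_card_of_nodup (hL.2.2 C hC)]
      exact hF _ (mem_of_lists hL.1 hC)
    rw [satisfiesAll_clauseConstraints _ _ _ hlen]
    simp only [List.mem_map, exists_exists_and_eq_and, holds_flipSelected,
      satisfiesAll_litConstraints A _ huniq]
  constructor
  · rintro ⟨A, hA⟩
    refine ⟨_, (hsat A).1 hA, ?_⟩
    -- Only the `r` selected variables are flipped, whence distance at most `r`.
    have hsub : ({x | α x ≠ flipSelected α tab A x} : Finset (Fin n)) ⊆
        Finset.univ.image fun i : Fin r => X i (A i) := by
      intro x hx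
      rw [Finset.mem_filter_univ] at hx
      have : Selects tab A x := by
        by_contra h
        simp [flipSelected, h] at hx
      obtain ⟨i, rfl⟩ := (hsel A x).1 this
      exact Finset.mem_image_of_mem _ (Finset.mem_univ i)
    exact (Finset.card_le_card hsub).trans (Finset.card_image_le.trans (by simp))
  · rintro ⟨β, hβ, hdist⟩
    -- The literal by which `β` satisfies the `i`-th false clause is false under `α`, so its
    -- variable is flipped.
    have hflip (i : Fin r) : ∃ j, α (X i j) ≠ β (X i j) := by
      obtain ⟨C, hC, h⟩ := hXF i
      obtain ⟨l, hl, hlβ⟩ := hβ C hC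
      obtain ⟨⟨j, hj⟩, hα⟩ := h l hl
      refine ⟨j, fun heq => hα ?_⟩
      rw [Literal.Holds, hj, heq, ← hj]
      exact hlβ
    choose j hj using hflip
    -- Values at indices from `r` on are irrelevant, because the table contains only indices below
    -- `r`.
    let A : ℕ → Fin 3 := fun i => if h : i < r then j ⟨i, h⟩ else 0
    have hA (i : Fin r) : A i = j i := by simp [A]
    refine ⟨A, (hsat A).2 ?_⟩
    have hsub : Finset.univ.image (fun i : Fin r => X i (j i)) ⊆
        ({x | α x ≠ β x} : Finset (Fin n)) := by
      intro x hx
      obtain ⟨i, -, rfl⟩ := Finset.mem_image.1 hx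
      exact Finset.mem_filter_univ _ |>.2 (hj i)
    -- The selected variables are `r` different ones and already exhaust the distance, so `β` flips
    -- no others.
    have heq := Finset.eq_of_subset_of_card_le hsub (by
      rw [Finset.card_image_of_injective _ fun i i' h => (hX _ _ _ _ h).1]
      simpa [hammingDist] using hdist)
    have : flipSelected α tab A = β := by
      funext x
      have hx : Selects tab A x ↔ α x ≠ β x := by
        rw [hsel, ← Finset.mem_filter_univ (p := fun x => α x ≠ β x), ← heq]
        simp [hA, eq_comm]
      simp only [flipSelected]
      split
      · have := hx.1 ‹_›
        revert this
        cases α x <;> cases β x <;> simp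
      · have := mt hx.2 ‹_›
        simpa using this
    rw [this]
    exact hβ

end Instances

/-! ### Covering codes for the directed distance on `ℤ / 3` -/

/-- Some translate of `S` contains at least the average share of `U`. -/
theorem exists_translate {Γ : Type*} [AddCommGroup Γ] [Fintype Γ] [DecidableEq Γ]
    (S U : Finset Γ) :
    ∃ c : Γ, (U.card : ℝ) * S.card / Fintype.card Γ ≤ (U.filter fun x => x - c ∈ S).card := by
  -- Double counting: each `x` lies in exactly `S.card` translates of `S`. Some `c` then reaches the
  -- average.
  have hsum : ∑ c : Γ, ((U.filter fun x => x - c ∈ S).card : ℝ) = U.card * S.card := by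
    have h (x : Γ) : (Finset.univ.filter fun c : Γ => x - c ∈ S).card = S.card :=
      Finset.card_bij' (fun c _ => x - c) (fun y _ => x - y) (by simp) (by simp) (by simp)
        (by simp)
    have := Finset.sum_card_bipartiteAbove_eq_sum_card_bipartiteBelow (s := U)
      (t := (Finset.univ : Finset Γ)) (fun x c => x - c ∈ S)
    simp only [Finset.bipartiteAbove, Finset.bipartiteBelow, h, Finset.sum_const,
      smul_eq_mul] at this
    exact_mod_cast this.symm
  obtain ⟨c, -, hc⟩ := Finset.exists_le_of_sum_le (s := (Finset.univ : Finset Γ))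
    (f := fun _ => (U.card : ℝ) * S.card / Fintype.card Γ)
    (g := fun c => ((U.filter fun x => x - c ∈ S).card : ℝ)) Finset.univ_nonempty (by
      rw [hsum, Finset.sum_const, Finset.card_univ, nsmul_eq_mul]
      exact (mul_div_cancel₀ _ (by simp)).le)
  exact ⟨c, hc⟩

/-- `N` translates of `S`, chosen greedily, leave few elements uncovered. -/
theorem exists_translates {Γ : Type*} [AddCommGroup Γ] [Fintype Γ] [DecidableEq Γ]
    (S : Finset Γ) (N : ℕ) :
    ∃ l : List Γ, l.length = N ∧
      ((Finset.univ.filter fun x : Γ => ∀ c ∈ l, x - c ∉ S).card : ℝ) ≤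
        Fintype.card Γ * (1 - S.card / Fintype.card Γ) ^ N := by
  induction N with
  | zero => exact ⟨[], rfl, by simp⟩
  | succ N ih =>
    obtain ⟨l, hl, hU⟩ := ih
    set U := Finset.univ.filter fun x : Γ => ∀ c ∈ l, x - c ∉ S
    obtain ⟨c, hc⟩ := exists_translate S U
    refine ⟨c :: l, by simp [hl], ?_⟩
    have hp : (0 : ℝ) ≤ 1 - S.card / Fintype.card Γ := by
      have h₁ : (S.card : ℝ) ≤ Fintype.card Γ := by exact_mod_cast Finset.card_le_univ S
      have h₂ : (0 : ℝ) < Fintype.card Γ := by exact_mod_cast Fintype.card_pos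
      rw [sub_nonneg, div_le_one h₂]
      exact h₁
    have hcard : ((Finset.univ.filter fun x : Γ => ∀ d ∈ c :: l, x - d ∉ S).card : ℝ) =
        U.card - (U.filter fun x => x - c ∈ S).card := by
      rw [eq_sub_iff_add_eq, ← Finset.card_filter_add_card_filter_not (s := U)
        (fun x => x - c ∈ S), Nat.cast_add, add_comm]
      congr 3
      ext x
      simp [U, and_comm]
    rw [hcard, pow_succ, ← mul_assoc]
    calc (U.card : ℝ) - (U.filter fun x => x - c ∈ S).card
        ≤ U.card - U.card * S.card / Fintype.card Γ := by linarith
      _ = U.card * (1 - S.card / Fintype.card Γ) := by ring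
      _ ≤ _ := mul_le_mul_of_nonneg_right hU hp

/-- The directed distance from the origin. -/
def weight {b : ℕ} (x : Fin b → Fin 3) : ℕ := ∑ i, (x i : ℕ)

/-- The sum factors over the coordinates, each contributing `1 + 1/3 + 1/9`. The base `1/3` is the
inverse of the branching factor of the local search. -/
theorem sum_weight (b : ℕ) :
    ∑ x : Fin b → Fin 3, (1 / 3 : ℝ) ^ weight x = (13 / 9 : ℝ) ^ b := by
  simp only [weight, ← Finset.prod_pow_eq_pow_sum]
  rw [← Fintype.piFinset_univ, Finset.sum_prod_piFinset _ fun _ (v : Fin 3) => (1 / 3 : ℝ) ^ (v : ℕ)]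
  simp [Fin.sum_univ_three]
  norm_num

theorem weight_le {b : ℕ} (x : Fin b → Fin 3) : weight x ≤ 2 * b := by
  refine (Finset.sum_le_card_nsmul _ _ 2 fun i _ => by omega).trans ?_
  simp [mul_comm]

/-- Some sphere is large in relation to the cost of its radius. -/
theorem exists_large_sphere (b : ℕ) : ∃ s ≤ 2 * b,
    (13 / 9 : ℝ) ^ b ≤
      (2 * b + 1) * (((Finset.univ.filter fun x : Fin b → Fin 3 => weight x = s).card : ℝ) *
        (1 / 3) ^ s) := by
  have h : ∑ s ∈ Finset.range (2 * b + 1),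
      ((Finset.univ.filter fun x : Fin b → Fin 3 => weight x = s).card : ℝ) * (1 / 3) ^ s =
        (13 / 9 : ℝ) ^ b := by
    rw [← sum_weight, ← Finset.sum_fiberwise_of_maps_to (t := Finset.range (2 * b + 1))
      (g := weight) fun x _ => by have := weight_le x; simp; omega]
    refine Finset.sum_congr rfl fun s _ => ?_
    rw [Finset.sum_congr rfl (g := fun _ => (1 / 3 : ℝ) ^ s), Finset.sum_const, nsmul_eq_mul]
    intro x hx
    rw [(Finset.mem_filter.1 hx).2]
  obtain ⟨s, hs, h⟩ := Finset.exists_le_of_sum_le (s := Finset.range (2 * b + 1))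
    (f := fun _ => (13 / 9 : ℝ) ^ b / (2 * b + 1)) (g := fun s =>
      ((Finset.univ.filter fun x : Fin b → Fin 3 => weight x = s).card : ℝ) * (1 / 3) ^ s)
    (by simp) (by
      rw [h, Finset.sum_const, Finset.card_range, nsmul_eq_mul]
      push_cast
      exact (mul_div_cancel₀ _ (by positivity)).le)
  refine ⟨s, by simp at hs; omega, ?_⟩
  rwa [div_le_iff₀' (by positivity)] at h

/-- With the sphere `S` of `exists_large_sphere`, about `2b · 3 ^ b / |S|` greedy translates
suffice. Times `3 ^ s` this is at most `3 ^ b · (9/13) ^ b` up to a polynomial factor, by the choice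
of `s`. -/
theorem exists_code (b : ℕ) : ∃ (s : ℕ) (l : List (Fin b → Fin 3)), s ≤ 2 * b ∧ l ≠ [] ∧
    (∀ x, ∃ c ∈ l, weight (x - c) = s) ∧
    (l.length : ℝ) * 3 ^ s ≤ (27 / 13 : ℝ) ^ b * ((2 * b + 1) * (2 * b + 2)) := by
  obtain ⟨s, hs, hS⟩ := exists_large_sphere b
  set S := Finset.univ.filter fun x : Fin b → Fin 3 => weight x = s
  have hcard : (Fintype.card (Fin b → Fin 3) : ℝ) = 3 ^ b := by simp
  have hS0 : (0 : ℝ) < S.card := by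
    by_contra! h
    have h0 : (S.card : ℝ) = 0 := le_antisymm h (by positivity)
    rw [h0] at hS
    have : (0 : ℝ) < (13 / 9 : ℝ) ^ b := by positivity
    linarith
  have hSle : (S.card : ℝ) ≤ 3 ^ b := by
    rw [← hcard]; exact_mod_cast Finset.card_le_univ S
  set q : ℝ := 3 ^ b / S.card with hq
  have hq1 : 1 ≤ q := (one_le_div hS0).2 hSle
  -- `N > 2bq` is what makes the bound `exp (2b - N / q)` on the number of uncovered points less
  -- than 1, and that number therefore 0.
  set N := ⌊q * (2 * b)⌋₊ + 1
  have hN : q * (2 * b) < N := by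
    simpa [N] using Nat.lt_floor_add_one (q * (2 * b))
  have hN' : (N : ℝ) ≤ q * (2 * b + 2) := by
    have := Nat.floor_le (show 0 ≤ q * (2 * b) by positivity)
    simp only [N]
    push_cast
    linarith
  obtain ⟨l, hl, hU⟩ := exists_translates S N
  refine ⟨s, l, hs, ?_, ?_, ?_⟩
  · rintro rfl
    simp [N] at hl
  · have hlt : (3 : ℝ) ^ b * (1 - S.card / 3 ^ b) ^ N < 1 := by
      have h₁ : (1 - S.card / 3 ^ b : ℝ) ≤ Real.exp (-(S.card / 3 ^ b)) :=
        Real.one_sub_le_exp_neg _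
      have h₀ : (0 : ℝ) ≤ 1 - S.card / 3 ^ b := by
        rw [sub_nonneg, div_le_one (by positivity)]; exact hSle
      -- The crude estimate `3 = 2 + 1 ≤ exp 2` is enough; it only costs a constant factor in `N`.
      have h₂ : (3 : ℝ) ^ b ≤ Real.exp (2 * b) := by
        rw [mul_comm, Real.exp_nat_mul]
        exact pow_le_pow_left₀ (by norm_num) (by linarith [Real.add_one_le_exp (2 : ℝ)]) b
      calc (3 : ℝ) ^ b * (1 - S.card / 3 ^ b) ^ N
          ≤ Real.exp (2 * b) * Real.exp (-(S.card / 3 ^ b)) ^ N := by gcongr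
        _ = Real.exp (2 * b - N * (S.card / 3 ^ b)) := by
            rw [← Real.exp_nat_mul, ← Real.exp_add]; ring_nf
        _ < 1 := by
            rw [Real.exp_lt_one_iff, sub_neg]
            have := mul_lt_mul_of_pos_right hN (show (0 : ℝ) < S.card / 3 ^ b by positivity)
            rwa [mul_right_comm, hq, div_mul_div_cancel₀ hS0.ne', div_self (by positivity),
              one_mul] at this
    rw [hcard] at hU
    have h0 := hU.trans_lt hlt
    have h0 : (Finset.univ.filter fun x : Fin b → Fin 3 => ∀ c ∈ l, x - c ∉ S).card = 0 := by
      have : (Finset.univ.filter fun x : Fin b → Fin 3 => ∀ c ∈ l, x - c ∉ S).card < 1 := by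
        exact_mod_cast h0
      omega
    intro x
    by_contra! h
    have : x ∈ Finset.univ.filter fun x : Fin b → Fin 3 => ∀ c ∈ l, x - c ∉ S := by
      simpa [S] using h
    rw [Finset.card_eq_zero] at h0
    rw [h0] at this
    simp at this
  · rw [hl]
    have h₁ : (3 : ℝ) ^ s / S.card ≤ (9 / 13) ^ b * (2 * b + 1) := by
      rw [div_le_iff₀ hS0]
      have h₂ := mul_le_mul_of_nonneg_left hS (show (0 : ℝ) ≤ 3 ^ s * (9 / 13) ^ b by positivity)
      have h₃ : (3 : ℝ) ^ s * (9 / 13) ^ b * (13 / 9) ^ b = 3 ^ s := by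
        rw [mul_assoc, ← mul_pow]; norm_num
      have h₄ : (3 : ℝ) ^ s * (1 / 3) ^ s = 1 := by rw [← mul_pow]; norm_num
      calc (3 : ℝ) ^ s = 3 ^ s * (9 / 13) ^ b * (13 / 9) ^ b := h₃.symm
        _ ≤ _ := h₂
        _ = (9 / 13) ^ b * (2 * b + 1) * S.card * (3 ^ s * (1 / 3) ^ s) := by ring
        _ = _ := by rw [h₄, mul_one]
    calc (N : ℝ) * 3 ^ s ≤ q * (2 * b + 2) * 3 ^ s := by gcongr
      _ = 3 ^ b * (3 ^ s / S.card) * (2 * b + 2) := by rw [hq]; ring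
      _ ≤ 3 ^ b * ((9 / 13) ^ b * (2 * b + 1)) * (2 * b + 2) := by gcongr
      _ = (3 * (9 / 13)) ^ b * ((2 * b + 1) * (2 * b + 2)) := by rw [mul_pow]; ring
      _ = _ := by norm_num

/-- Since `27/13 < 2.077`, the quotient decays exponentially and beats the quadratic factor. The
leading 2 is reserved for listing the code twice in `exists_covers`. -/
theorem exists_block_length : ∃ b : ℕ, 0 < b ∧
    2 * ((27 / 13 : ℝ) ^ b * ((2 * b + 1) * (2 * b + 2))) ≤ 2.077 ^ b := by
  have h := tendsto_pow_const_mul_const_pow_of_abs_lt_one 2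
    (show |(27 / 13 / 2.077 : ℝ)| < 1 by rw [abs_of_pos] <;> norm_num)
  -- For `b ≥ 1`, `2 (2b + 1)(2b + 2) ≤ 2 · 3b · 4b = 24 b ^ 2`.
  obtain ⟨b, hb, hb'⟩ := ((h.eventually_le_const (show (0 : ℝ) < 1 / 24 by norm_num)).and
    (Filter.eventually_ge_atTop 1)).exists
  refine ⟨b, hb', ?_⟩
  have hb1 : (1 : ℝ) ≤ b := by exact_mod_cast hb'
  have hpow : (27 / 13 : ℝ) ^ b = (27 / 13 / 2.077) ^ b * 2.077 ^ b := by
    rw [← mul_pow]; norm_num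
  have hpos : (0 : ℝ) < (27 / 13 / 2.077) ^ b := by positivity
  have h1 : 2 * ((27 / 13 / 2.077 : ℝ) ^ b * ((2 * b + 1) * (2 * b + 2))) ≤ 1 := by
    have : ((2 * b + 1) * (2 * b + 2) : ℝ) ≤ 12 * b ^ 2 := by nlinarith
    nlinarith [mul_le_mul_of_nonneg_left this hpos.le]
  rw [hpow]
  nlinarith [show (0 : ℝ) < 2.077 ^ b by positivity]

/-- The directed distance from the block `c`, placed at the variables `i, i + 1, …` from its end,
to the assignment `x`. -/
def blockDist (x : ℕ → Fin 3) (i : ℕ) : List (Fin 3) → ℕ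
  | [] => 0
  | v :: c => blockDist x i c + (x (i + c.length) - v : Fin 3)

/-- Blocks are assigned by a right fold, the last entry first; hence the reversed coordinates. -/
theorem blockDist_ofFn (x : ℕ → Fin 3) (i : ℕ) {b : ℕ} (c : Fin b → Fin 3) :
    blockDist x i (List.ofFn c) = weight ((fun k : Fin b => x (i + (b - 1 - k))) - c) := by
  induction b with
  | zero => simp [blockDist, weight]
  | succ b ih =>
    rw [List.ofFn_succ, blockDist, ih, weight, weight, Fin.sum_univ_succ, add_comm]
    congr 1
    · simp
    · refine Finset.sum_congr rfl fun k _ => ?_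
      simp only [Pi.sub_apply, Fin.val_succ]
      congr 4
      omega

/-- A list of blocks and radii, such that the balls cover all assignments to a block. -/
structure Covers (b : ℕ) (K : List (List (Fin 3) × ℕ)) : Prop where
  length : ∀ k ∈ K, k.1.length = b
  radius : ∀ k ∈ K, k.2 ≤ 2 * b
  covers : ∀ x i, ∃ k ∈ K, blockDist x i k.1 ≤ k.2

/-- The number of leaves of the local search in the balls of a code. -/
def codeCost (K : List (List (Fin 3) × ℕ)) : ℕ := (K.map fun k => 3 ^ k.2).sum

theorem exists_covers : ∃ b K, 0 < b ∧ Covers b K ∧ 2 ≤ K.length ∧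
    (codeCost K : ℝ) ≤ 2.077 ^ b := by
  obtain ⟨b, hb, hcost⟩ := exists_block_length
  obtain ⟨s, l, hs, hl, hcov, hle⟩ := exists_code b
  have hl' := List.length_pos_of_ne_nil hl
  -- The code is listed twice only to guarantee at least two children at each block extension, which
  -- the node count needs.
  refine ⟨b, (l ++ l).map fun c => (List.ofFn c, s), hb, ⟨?_, ?_, ?_⟩, ?_, ?_⟩
  · simp only [List.mem_map]
    rintro _ ⟨c, -, rfl⟩
    simp
  · simp only [List.mem_map]
    rintro _ ⟨c, -, rfl⟩
    exact hs
  · intro x i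
    obtain ⟨c, hc, h⟩ := hcov fun k => x (i + (b - 1 - k))
    refine ⟨_, List.mem_map.2 ⟨c, by simp [hc], rfl⟩, ?_⟩
    rw [blockDist_ofFn, h]
  · simp only [List.length_map, List.length_append]
    omega
  · have : codeCost ((l ++ l).map fun c => (List.ofFn c, s)) = 2 * (l.length * 3 ^ s) := by
      simp [codeCost, Function.comp_def]
      ring
    rw [this]
    push_cast
    linarith

/-- The exhaustive code of radius 0, used when fewer than `b` variables are left. -/
theorem covers_one : Covers 1 [([0], 0), ([1], 0), ([2], 0)] where
  length := by simp
  radius := by simp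
  covers x i := by
    generalize h : x i = v
    fin_cases v <;> simp [blockDist, h]

/-! ### Tree search -/

/-- An accepting node can be reached from the node `s`. -/
inductive Reaches {S : Type} (acc : S → Bool) (ch : S → List S) : S → Prop
  | here {s : S} (h : acc s = true) : Reaches acc ch s
  | step {s t : S} (ht : t ∈ ch s) (h : Reaches acc ch t) : Reaches acc ch s

theorem reaches_iff {S : Type} {acc : S → Bool} {ch : S → List S} {s : S} :
    Reaches acc ch s ↔ acc s = true ∨ ∃ t ∈ ch s, Reaches acc ch t := by
  constructor
  · rintro (h | ⟨ht, h⟩)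
    · exact .inl h
    · exact .inr ⟨_, ht, h⟩
  · rintro (h | ⟨t, ht, h⟩)
    · exact .here h
    · exact .step ht h

open Classical in
/-- Depth-first search takes time proportional to the number of nodes, which is bounded by any
function `W` that exceeds at each node the sum of its values at the children. -/
theorem TimeBound.search {A C S : Type} [Enc A] [Enc C] [Enc S] {acc : C × S → Bool}
    {ch : C × S → List S} {T U : C × S → ℕ} (hacc : TimeBound acc T) (hch : TimeBound ch U)
    {c : A → C} {l : A → List S} {V : A → ℕ} (hcl : TimeBound (fun a => (c a, l a)) V)
    {Inv : A → S → Prop} {W : A → S → ℕ} {M : A → ℕ} (hl : ∀ a, ∀ s ∈ l a, Inv a s)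
    (hInv : ∀ a s, Inv a s → ∀ t ∈ ch (c a, s), Inv a t)
    (hM : ∀ a s, Inv a s → T (c a, s) + U (c a, s) ≤ M a)
    (hW : ∀ a s, Inv a s → ((ch (c a, s)).map (W a)).sum + 1 ≤ W a s) :
    TimeBound
      (fun a => decide (∃ s ∈ l a, Reaches (fun s => acc (c a, s)) (fun s => ch (c a, s)) s))
      fun a => V a + ((l a).map (W a)).sum * (M a + 40) + 10 := by
  intro n
  obtain ⟨Q, e, hcl⟩ := hcl n
  obtain ⟨Q', i, hacc⟩ := hacc.exists_function (n + Q.length)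
  obtain ⟨Q'', f, hch⟩ := hch.exists_function (n + Q.length + Q'.length)
  let k := n + Q.length + Q'.length + Q''.length
  let node : Expr := .cons (.hd .arg) (.hd (.tl .arg))
  let body : Expr := .ite (.tl .arg) (.ite (.call i node) (.cons .nil .nil)
    (.ite (.call k (.cons (.hd .arg) (.call f node))) (.cons .nil .nil)
      (.call k (.cons (.hd .arg) (.tl (.tl .arg)))))) .nil
  refine ⟨Q ++ Q' ++ Q'' ++ [body], .call k e, fun P R hP a => ?_⟩
  have hcl := hcl P (Q' ++ Q'' ++ [body] ++ R) hP a
  obtain ⟨ei, hi', hi⟩ := hacc (P ++ Q) (Q'' ++ [body] ++ R) (by simp [hP])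
  obtain ⟨ef, hf', hf⟩ := hch (P ++ Q ++ Q') ([body] ++ R) (by simp [hP]; omega)
  have hk : (P ++ (Q ++ Q' ++ Q'' ++ [body]) ++ R)[k]? = some body := by
    have : P ++ (Q ++ Q' ++ Q'' ++ [body]) ++ R = (P ++ Q ++ Q' ++ Q'') ++ (body :: R) := by simp
    rw [this, List.getElem?_append_right (by simp [k, hP]; omega)]
    simp [k, hP, ← add_assoc]
  simp only [List.append_assoc] at hcl hi' hi hf' hf hk ⊢
  generalize P ++ (Q ++ (Q' ++ (Q'' ++ ([body] ++ R)))) = P' at *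
  set Re := Reaches (fun s => acc (c a, s)) (fun s => ch (c a, s))
  -- Induction on the total `W` of the pending nodes. It drops both on descending to the children of
  -- `s` and on passing to its siblings, because `W a s` exceeds the sum over the children by at
  -- least 1.
  have key : ∀ (N : ℕ) (l : List S), (∀ s ∈ l, Inv a s) → (l.map (W a)).sum = N →
      EvalsIn P' (.cons (enc (c a)) (enc l)) body (enc (decide (∃ s ∈ l, Re s)))
        (N * (M a + 40) + 5) := by
    intro N
    induction N using Nat.strong_induction_on with
    | _ N ih =>
      intro l hl hN
      cases l with
      | nil =>
        have : (decide (∃ s ∈ ([] : List S), Re s)) = false := by simp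
        rw [this]
        exact (EvalsIn.ite_nil (EvalsIn.tl .arg) .nil).mono (by omega)
      | cons s l =>
        have hs := hl s (by simp)
        have hWs := hW a s hs
        have hMs := hM a s hs
        simp only [List.map_cons, List.sum_cons] at hN
        have ih₁ := ih _ (show ((ch (c a, s)).map (W a)).sum < N by omega) _ (hInv a s hs) rfl
        have ih₂ := ih _ (show (l.map (W a)).sum < N by omega) l
          (fun t ht => hl t (by simp [ht])) rfl
        have hnode : EvalsIn P' (.cons (enc (c a)) (enc (s :: l))) node (enc (c a, s)) 6 :=
          (EvalsIn.hd .arg).cons (EvalsIn.hd (EvalsIn.tl .arg))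
        have h₁ := hnode.call hi' (hi _)
        have h₂ := ((EvalsIn.hd (x := .cons (enc (c a)) (enc (s :: l))) .arg).cons
          (hnode.call hf' (hf _))).call hk ih₁
        have h₃ := ((EvalsIn.hd (x := .cons (enc (c a)) (enc (s :: l))) .arg).cons
          (EvalsIn.tl (EvalsIn.tl .arg))).call hk ih₂
        have htrue : EvalsIn P' (.cons (enc (c a)) (enc (s :: l))) (.cons .nil .nil)
            (enc true) 3 := .cons .nil .nil
        have hRe : Re s ↔ acc (c a, s) = true ∨ ∃ t ∈ ch (c a, s), Re t := reaches_iff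
        have hcond : EvalsIn P' (.cons (enc (c a)) (enc (s :: l))) (.tl .arg)
            (.cons (enc s) (enc l)) 2 := EvalsIn.tl .arg
        have hle : (((ch (c a, s)).map (W a)).sum * (M a + 40)) +
            (l.map (W a)).sum * (M a + 40) + (M a + 40) ≤ N * (M a + 40) := by
          rw [← add_mul, ← Nat.succ_mul]
          exact Nat.mul_le_mul_right _ (by omega)
        cases hA : acc (c a, s) with
        | true =>
          have : decide (∃ t ∈ s :: l, Re t) = true :=
            decide_eq_true ⟨s, by simp, hRe.2 (.inl hA)⟩
          rw [this]
          rw [hA] at h₁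
          exact (hcond.ite_cons (h₁.ite_cons htrue)).mono (by omega)
        | false =>
          rw [hA] at h₁
          by_cases hC : ∃ t ∈ ch (c a, s), Re t
          · have : decide (∃ t ∈ s :: l, Re t) = true :=
              decide_eq_true ⟨s, by simp, hRe.2 (.inr hC)⟩
            rw [this]
            rw [decide_eq_true hC] at h₂
            exact (hcond.ite_cons (h₁.ite_nil (h₂.ite_cons htrue))).mono (by omega)
          · have : decide (∃ t ∈ s :: l, Re t) = decide (∃ t ∈ l, Re t) := by
              simp [hRe, hA, hC]
            rw [this]
            rw [decide_eq_false hC] at h₂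
            exact (hcond.ite_cons (h₁.ite_nil (h₂.ite_nil h₃))).mono (by omega)
  exact (hcl.call hk (key _ (l a) (hl a) rfl)).mono (by omega)

/-! ### The search for a satisfying assignment -/

/-- A partial assignment: the number of variables with a value, and the list of their values. -/
abbrev Partial : Type := ℕ × List (ℕ × Fin 3)

/-- A state of the search: the number of variables without a value, the remaining radius, and a
partial assignment. -/
abbrev SearchState : Type := ℕ × ℕ × Partial

/-- Assign the values of a block to the next variables. -/
def pushBlock (c : List (Fin 3)) (t : Partial) : Partial :=
  c.foldr (fun v t => (t.1 + 1, [(t.1, v)] ++ t.2)) t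

/-- All literals of the constraint are false. -/
def violated (a : List (ℕ × Fin 3)) (c : RawConstraint) : Bool :=
  c.all fun p => a.any fun q => q.1 == p.1 && q.2 == p.2

/-- Increment the value of `x`. -/
def bump (x : ℕ) (a : List (ℕ × Fin 3)) : List (ℕ × Fin 3) :=
  a.map fun q => if q.1 == x then (q.1, q.2 + 1) else q

/-- The violated constraints. -/
def violations (G : List RawConstraint) (a : List (ℕ × Fin 3)) : List RawConstraint :=
  G.filter fun c => violated a c

/-- All variables have values, which satisfy all constraints. -/
def accepting (G : List RawConstraint) (s : SearchState) : Bool :=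
  s.1 == 0 && (violations G s.2.2.2).isEmpty

/-- Extend the partial assignment by the blocks of a code. -/
def extensions (b : ℕ) (K : List (List (Fin 3) × ℕ)) (s : SearchState) : List SearchState :=
  K.map fun k => (s.1 - b, s.2.1 + k.2, pushBlock k.1 s.2.2)

/-- Change the value of one of the variables of a violated constraint. -/
def corrections (G : List RawConstraint) (s : SearchState) : List SearchState :=
  if s.2.1 == 0 then []
  else ((violations G s.2.2.2).headD []).map fun p =>
    (0, s.2.1 - 1, s.2.2.1, bump p.1 s.2.2.2)

/-- The children of a state. -/
def children (b : ℕ) (K : List (List (Fin 3) × ℕ)) (G : List RawConstraint) (s : SearchState) :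
    List SearchState :=
  if s.1 == 0 then corrections G s
  -- For `b > 0` the truncated difference vanishes iff fewer than `b` variables remain.
  else if s.1 - (b - 1) == 0 then extensions 1 [([0], 0), ([1], 0), ([2], 0)] s
  else extensions b K s

namespace PolyC

theorem pushBlock : PolyC fun p : List (Fin 3) × Partial => pushBlock p.1 p.2 :=
  foldr_counter (g := fun _ v m => [(m, v)]) id.fst id.snd
    (cons (id.snd.snd.pair id.snd.fst) (const []))

theorem violated : PolyC fun p : List (ℕ × Fin 3) × RawConstraint => violated p.1 p.2 :=
  all (f := fun (p : List (ℕ × Fin 3) × RawConstraint) (l : ℕ × Fin 3) => p.1.any fun q => q.1 == l.1 && q.2 == l.2)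
    (any (f := fun (p : (List (ℕ × Fin 3) × RawConstraint) × (ℕ × Fin 3)) (q : ℕ × Fin 3) =>
        q.1 == p.2.1 && q.2 == p.2.2)
      ((id.snd.fst.nat_beq id.fst.snd.fst).and (id.snd.snd.fin_beq id.fst.snd.snd)) id.fst.fst)
    id.snd

theorem bump : PolyC fun p : ℕ × List (ℕ × Fin 3) => bump p.1 p.2 :=
  map (f := fun p q => if q.1 == p.1 then (q.1, q.2 + 1) else q)
    ((id.snd.fst.nat_beq id.fst.fst).ite (id.snd.fst.pair id.snd.snd.fin_succ) id.snd) id.snd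

theorem violations : PolyC fun p : List RawConstraint × List (ℕ × Fin 3) =>
    violations p.1 p.2 :=
  filter (f := fun p c => BallSat.violated p.2 c) (violated.comp (id.fst.snd.pair id.snd)) id.fst

theorem accepting : PolyC fun p : List RawConstraint × SearchState => accepting p.1 p.2 :=
  id.snd.fst.nat_isZero.and
    (violations.comp (id.fst.pair id.snd.snd.snd.snd)).isEmpty

theorem extensions (b : ℕ) (K : List (List (Fin 3) × ℕ)) :
    PolyC fun s : SearchState => extensions b K s :=
  map (f := fun (s : SearchState) (k : List (Fin 3) × ℕ) => (s.1 - b, s.2.1 + k.2, BallSat.pushBlock k.1 s.2.2))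
    ((id.fst.fst.sub_const b).pair ((id.fst.snd.fst.nat_add id.snd.snd).pair
      (pushBlock.comp (id.snd.fst.pair id.fst.snd.snd)))) (const K)

theorem corrections : PolyC fun p : List RawConstraint × SearchState => corrections p.1 p.2 :=
  id.snd.snd.fst.nat_isZero.ite (const [])
    (map (f := fun (p : List RawConstraint × SearchState) l => (0, p.2.2.1 - 1, p.2.2.2.1, BallSat.bump l.1 p.2.2.2.2))
      ((const 0).pair ((id.fst.snd.snd.fst.sub_const 1).pair (id.fst.snd.snd.snd.fst.pair
        (bump.comp (id.snd.fst.pair id.fst.snd.snd.snd.snd)))))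
      ((violations.comp (id.fst.pair id.snd.snd.snd.snd)).headD []))

theorem children (b : ℕ) (K : List (List (Fin 3) × ℕ)) :
    PolyC fun p : List RawConstraint × SearchState => children b K p.1 p.2 :=
  id.snd.fst.nat_isZero.ite corrections
    ((id.snd.fst.sub_const (b - 1)).nat_isZero.ite ((extensions 1 _).comp id.snd)
      ((extensions b K).comp id.snd))

end PolyC

/-! ### Correctness of the search -/

/-- The partial assignment gives the values of `A` to the first variables. -/
structure Represents (t : Partial) (A : ℕ → Fin 3) : Prop where
  mem : ∀ p, p ∈ t.2 ↔ p.1 < t.1 ∧ p.2 = A p.1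
  length : t.2.length = t.1

/-- The directed distance on the first `m` variables. -/
def prefixDist (x A : ℕ → Fin 3) (m : ℕ) : ℕ := ∑ i ∈ Finset.range m, (x i - A i : Fin 3).val

theorem represents_empty (A : ℕ → Fin 3) : Represents (0, []) A := ⟨by simp, rfl⟩

theorem prefixDist_update (x A : ℕ → Fin 3) (m : ℕ) (v : Fin 3) :
    prefixDist x (Function.update A m v) m = prefixDist x A m := by
  refine Finset.sum_congr rfl fun i hi => ?_
  rw [Function.update_of_ne (Finset.mem_range.1 hi).ne]

theorem Represents.push {t : Partial} {A : ℕ → Fin 3} (h : Represents t A) (v : Fin 3) :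
    Represents (t.1 + 1, [(t.1, v)] ++ t.2) (Function.update A t.1 v) where
  mem p := by
    obtain ⟨i, w⟩ := p
    simp only [List.singleton_append, List.mem_cons, h.mem, Prod.mk.injEq]
    by_cases hi : i = t.1
    · subst hi; simp
    · rw [Function.update_of_ne hi]
      simp only [hi, false_and, false_or]
      constructor
      · rintro ⟨h₁, h₂⟩; exact ⟨by omega, h₂⟩
      · rintro ⟨h₁, h₂⟩; exact ⟨by omega, h₂⟩
  length := by simp [h.length]

theorem pushBlock_fst (c : List (Fin 3)) (t : Partial) :
    (pushBlock c t).1 = t.1 + c.length := by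
  induction c with
  | nil => rfl
  | cons v c ih =>
    change (pushBlock c t).1 + 1 = _
    rw [ih, List.length_cons]
    omega

theorem Represents.pushBlock {t : Partial} {A : ℕ → Fin 3} (h : Represents t A)
    (c : List (Fin 3)) (x : ℕ → Fin 3) :
    ∃ A', Represents (pushBlock c t) A' ∧
      prefixDist x A' (BallSat.pushBlock c t).1 = prefixDist x A t.1 + blockDist x t.1 c := by
  induction c with
  | nil => exact ⟨A, h, rfl⟩
  | cons v c ih =>
    obtain ⟨A', hA', hd⟩ := ih
    refine ⟨_, hA'.push v, ?_⟩
    change prefixDist x _ ((BallSat.pushBlock c t).1 + 1) = _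
    rw [prefixDist, Finset.sum_range_succ, ← prefixDist, prefixDist_update, hd,
      Function.update_self, pushBlock_fst]
    simp only [blockDist]
    omega

theorem Represents.bump {t : Partial} {A : ℕ → Fin 3} (h : Represents t A) (i : ℕ) :
    Represents (t.1, bump i t.2) (Function.update A i (A i + 1)) where
  mem p := by
    obtain ⟨j, w⟩ := p
    simp only [BallSat.bump, List.mem_map, h.mem]
    constructor
    · rintro ⟨⟨k, u⟩, ⟨hk, hu⟩, heq⟩
      dsimp only at hk hu heq
      subst hu
      by_cases hki : k = i
      · simp only [hki, beq_self_eq_true, if_true, Prod.mk.injEq] at heq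
        obtain ⟨rfl, rfl⟩ := heq
        exact ⟨hki ▸ hk, by simp⟩
      · simp only [beq_iff_eq, hki, if_false, Prod.mk.injEq] at heq
        obtain ⟨rfl, rfl⟩ := heq
        exact ⟨hk, by simp [hki]⟩
    · rintro ⟨hj, hw⟩
      refine ⟨(j, A j), ⟨hj, rfl⟩, ?_⟩
      by_cases hji : j = i
      · subst hji; simp [hw]
      · simp [hji, hw]
  length := by simp [BallSat.bump, h.length]

/-- The reason for the directed distance: one and the same move, `v ↦ v + 1`, is progress towards
either of the other two values. -/
theorem val_sub_add_one {u v : Fin 3} (h : u ≠ v) : (u - (v + 1)).val + 1 = (u - v).val := by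
  revert u v; decide

theorem prefixDist_bump {x A : ℕ → Fin 3} {m i : ℕ} (hi : i < m) (h : x i ≠ A i) :
    prefixDist x (Function.update A i (A i + 1)) m + 1 = prefixDist x A m := by
  have hi := Finset.mem_range.2 hi
  rw [prefixDist, prefixDist, ← Finset.add_sum_erase _ _ hi, ← Finset.add_sum_erase _ _ hi,
    Function.update_self, ← val_sub_add_one h]
  have : ∑ k ∈ (Finset.range m).erase i, (x k - Function.update A i (A i + 1) k : Fin 3).val =
      ∑ k ∈ (Finset.range m).erase i, (x k - A k : Fin 3).val :=
    Finset.sum_congr rfl fun k hk => by rw [Function.update_of_ne (Finset.ne_of_mem_erase hk)]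
  omega

theorem violated_iff {t : Partial} {A : ℕ → Fin 3} (h : Represents t A) {k : ℕ}
    {c : RawConstraint} (hc : Valid k t.1 c) :
    violated t.2 c = true ↔ ∀ p ∈ c, A p.1 = p.2 := by
  simp only [violated, List.all_eq_true, List.any_eq_true, Bool.and_eq_true, beq_iff_eq]
  refine forall₂_congr fun p hp => ?_
  constructor
  · rintro ⟨q, hq, h₁, h₂⟩
    rw [← h₁, ← h₂, ((h.mem q).1 hq).2]
  · intro hA
    exact ⟨p, (h.mem p).2 ⟨hc.2 p hp, hA.symm⟩, rfl, rfl⟩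

theorem violations_eq_nil_iff {t : Partial} {A : ℕ → Fin 3} (h : Represents t A) {k : ℕ}
    {G : List RawConstraint} (hG : ∀ c ∈ G, Valid k t.1 c) :
    violations G t.2 = [] ↔ SatisfiesAll A G := by
  simp only [violations, List.filter_eq_nil_iff, SatisfiesAll]
  refine forall₂_congr fun c hc => ?_
  rw [violated_iff h (hG c hc)]
  push Not
  rfl

/-- The invariant of the search for `r` variables. -/
structure SearchInv (r : ℕ) (s : SearchState) : Prop where
  total : s.1 + s.2.2.1 = r
  -- A block of length `b` adds at most `2 * b` to the radius. This keeps the unary radius, and with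
  -- it the state, of polynomial size.
  radius : s.2.1 + 2 * s.1 ≤ 2 * r
  represents : ∃ A, Represents s.2.2 A

variable {r b : ℕ} {K : List (List (Fin 3) × ℕ)} {G : List RawConstraint}

theorem searchInv_start (r : ℕ) : SearchInv r (r, 0, 0, []) :=
  ⟨by simp, by simp, fun _ => 0, represents_empty _⟩

theorem SearchInv.extensions (hK : Covers b K) {s : SearchState} (hs : SearchInv r s)
    (hb : b ≤ s.1) : ∀ t ∈ extensions b K s, SearchInv r t := by
  intro t ht
  obtain ⟨k, hk, rfl⟩ := List.mem_map.1 ht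
  have h₁ := hs.total
  have h₂ := hs.radius
  have h₃ := hK.length k hk
  have h₄ := hK.radius k hk
  obtain ⟨A, hA⟩ := hs.represents
  obtain ⟨A', hA', -⟩ := hA.pushBlock k.1 A
  refine ⟨?_, ?_, A', hA'⟩
  · simp only [pushBlock_fst]
    omega
  · dsimp only
    omega

theorem SearchInv.corrections {s : SearchState} (hs : SearchInv r s) (h0 : s.1 = 0) :
    ∀ t ∈ corrections G s, SearchInv r t := by
  intro t ht
  have h₁ := hs.total
  have h₂ := hs.radius
  obtain ⟨A, hA⟩ := hs.represents
  unfold BallSat.corrections at ht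
  split at ht
  · simp at ht
  · obtain ⟨p, hp, rfl⟩ := List.mem_map.1 ht
    exact ⟨by dsimp only; omega, by dsimp only; omega, _, hA.bump p.1⟩

theorem SearchInv.children (hK : Covers b K) {s : SearchState} (hs : SearchInv r s) :
    ∀ t ∈ children b K G s, SearchInv r t := by
  unfold BallSat.children
  split
  · rename_i h0
    exact hs.corrections (by simpa using h0)
  · rename_i h0
    have h0 : s.1 ≠ 0 := by simpa using h0
    split
    · exact hs.extensions covers_one (by omega)
    · rename_i h
      have h : s.1 - (b - 1) ≠ 0 := by simpa using h
      exact hs.extensions hK (by omega)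

theorem sound_of_reaches (hK : Covers b K) (hG : ∀ c ∈ G, Valid 3 r c) {s : SearchState}
    (hs : SearchInv r s) (h : Reaches (accepting G) (children b K G) s) :
    ∃ A, SatisfiesAll A G := by
  induction h with
  | here h =>
    simp only [accepting, Bool.and_eq_true, beq_iff_eq, List.isEmpty_iff] at h
    obtain ⟨A, hA⟩ := hs.represents
    have hr := hs.total
    rw [h.1, zero_add] at hr
    exact ⟨A, (violations_eq_nil_iff hA (k := 3) (by rw [hr]; exact hG)).1 h.2⟩
  | step ht _ ih => exact ih (hs.children hK _ ht)

/-- In a violated constraint, `x` satisfies some literal that `A` falsifies. The branch that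
increments its variable is one step closer to `x`. At radius 0, `A` and `x` agree below `r`. -/
theorem reaches_of_local {x : ℕ → Fin 3} (hx : SatisfiesAll x G) (hG : ∀ c ∈ G, Valid 3 r c)
    (k : ℕ) : ∀ {a A}, Represents (r, a) A → prefixDist x A r ≤ k →
      Reaches (accepting G) (children b K G) (0, k, r, a) := by
  induction k with
  | zero =>
    intro a A hA hd
    refine .here ?_
    have : violations G a = [] := by
      rw [violations_eq_nil_iff hA hG]
      intro c hc
      obtain ⟨p, hp, hne⟩ := hx c hc
      refine ⟨p, hp, fun hAp => hne ?_⟩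
      rw [← hAp]
      by_contra h
      have := prefixDist_bump ((hG c hc).2 p hp) h
      omega
    simp [accepting, this]
  | succ k ih =>
    intro a A hA hd
    cases hv : violations G a with
    | nil => exact .here (by simp [accepting, hv])
    | cons c V =>
      have hc : c ∈ G ∧ violated a c = true := by
        rw [← List.mem_filter (p := fun c => violated a c)]
        change c ∈ violations G a
        simp [hv]
      obtain ⟨p, hp, hne⟩ := hx c hc.1
      have hAp := (violated_iff hA (hG c hc.1)).1 hc.2 p hp
      have hdist := prefixDist_bump ((hG c hc.1).2 p hp) (hAp ▸ hne)
      refine .step (t := (0, k, r, bump p.1 a)) ?_ (ih (hA.bump p.1) (by omega))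
      simp only [children, corrections, hv]
      simp only [beq_self_eq_true, if_true, List.headD_cons]
      exact List.mem_map.2 ⟨p, hp, rfl⟩

/-- On the branch of the covering codewords, the distance to `x` on the assigned prefix stays within
the accumulated radius; once `m = 0`, local search finishes. -/
theorem reaches_of_satisfiesAll (hb : 0 < b) (hK : Covers b K) {x : ℕ → Fin 3}
    (hx : SatisfiesAll x G) (hG : ∀ c ∈ G, Valid 3 r c) (m : ℕ) :
    ∀ {k t A}, Represents t A → m + t.1 = r → prefixDist x A t.1 ≤ k →
      Reaches (accepting G) (children b K G) (m, k, t) := by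
  induction m using Nat.strong_induction_on with
  | _ m ih =>
    intro k t A hA hr hd
    by_cases h0 : m = 0
    · subst h0
      obtain ⟨i, a⟩ := t
      obtain rfl : i = r := by simpa using hr
      exact reaches_of_local hx hG k hA hd
    · have key : ∀ {d L}, 0 < d → d ≤ m → Covers d L →
          ∃ u ∈ extensions d L (m, k, t), Reaches (accepting G) (children b K G) u := by
        intro d L hd0 hdm hL
        obtain ⟨p, hp, hdist⟩ := hL.covers x t.1
        obtain ⟨A', hA', hpre⟩ := hA.pushBlock p.1 x
        have hlen := pushBlock_fst p.1 t
        have := hL.length p hp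
        exact ⟨_, List.mem_map.2 ⟨p, hp, rfl⟩,
          ih (m - d) (by omega) (t := pushBlock p.1 t) hA' (by omega) (by dsimp only; omega)⟩
      have hch : ∃ u ∈ children b K G (m, k, t), Reaches (accepting G) (children b K G) u := by
        by_cases hbm : m - (b - 1) = 0
        · simpa [children, h0, hbm] using key one_pos (by omega) covers_one
        · simpa [children, h0, hbm] using key hb (by omega) hK
      obtain ⟨u, hu, hre⟩ := hch
      exact .step hu hre

/-! ### The number of nodes of the search -/

/-- A bound on the number of nodes below a state. -/
def nodeBound (b : ℕ) (K : List (List (Fin 3) × ℕ)) (s : SearchState) : ℕ :=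
  2 * (codeCost K ^ (s.1 / b) * 3 ^ (s.1 % b) * 3 ^ s.2.1) - 1

theorem sum_two_mul_sub_one (X : ℕ) (hX : 0 < X) (L : List ℕ) :
    (L.map fun e => 2 * (X * 3 ^ e) - 1).sum + L.length = 2 * (X * (L.map (3 ^ ·)).sum) := by
  induction L with
  | nil => simp
  | cons e L ih =>
    have : 0 < X * 3 ^ e := by positivity
    simp only [List.map_cons, List.sum_cons, List.length_cons, mul_add]
    omega

theorem codeCost_pos (hK : 2 ≤ K.length) : 0 < codeCost K := by
  cases K with
  | nil => simp at hK
  | cons k K => simp [codeCost]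

/-- `nodeBound` is `2ℓ - 1` for an estimate `ℓ` of the number of leaves. If the estimates at `d`
children add up to `ℓ`, the bounds add up to `2ℓ - d`, so `d ≥ 2` suffices. A correction may have
fewer children, but its estimate always allows for three. -/
theorem sum_nodeBound_children (hb : 0 < b) (hK : 2 ≤ K.length) (hG : ∀ c ∈ G, Valid 3 r c)
    (s : SearchState) :
    ((children b K G s).map (nodeBound b K)).sum + 1 ≤ nodeBound b K s := by
  obtain ⟨m, k, t⟩ := s
  have hpos := codeCost_pos hK
  have h3 : 0 < 3 ^ k := by positivity
  by_cases h0 : m = 0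
  · subst h0
    cases k with
    | zero => simp [children, corrections, nodeBound]
    | succ k =>
      have hlen : ((violations G t.2).headD []).length ≤ 3 := by
        cases hv : violations G t.2 with
        | nil => simp
        | cons c V =>
          have : c ∈ violations G t.2 := by simp [hv]
          exact (hG c (List.mem_filter.1 this).1).1
      simp only [children, corrections, nodeBound, beq_self_eq_true, if_true, List.map_map,
        Function.comp_def, Nat.zero_div, Nat.zero_mod, pow_zero, one_mul, Nat.add_sub_cancel,
        Nat.add_one_ne_zero, beq_iff_eq, if_false, List.map_const', List.sum_replicate,
        smul_eq_mul]
      have h3 : 0 < 3 ^ k := by positivity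
      have := Nat.mul_le_mul_right (2 * 3 ^ k - 1) hlen
      rw [pow_succ]
      omega
  · by_cases hbm : m - (b - 1) = 0
    · have hlt : m < b := by omega
      have h₁ : (m - 1) / b = 0 := Nat.div_eq_of_lt (by omega)
      have h₂ : (m - 1) % b = m - 1 := Nat.mod_eq_of_lt (by omega)
      have h₃ : (3 : ℕ) ^ m = 3 ^ (m - 1) * 3 := by rw [← pow_succ]; congr 1; omega
      have h₄ : 0 < 3 ^ (m - 1) * 3 ^ k := by positivity
      simp only [children, extensions, beq_iff_eq, h0, hbm, if_true, if_false, List.map_cons,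
        List.map_nil, List.sum_cons, List.sum_nil, nodeBound, h₁, h₂, Nat.div_eq_of_lt hlt,
        Nat.mod_eq_of_lt hlt, pow_zero, one_mul, h₃, add_zero]
      rw [mul_right_comm]
      omega
    · have hle : b ≤ m := by omega
      have h₁ : m / b = (m - b) / b + 1 := by rw [← Nat.add_div_right _ hb, Nat.sub_add_cancel hle]
      have h₂ : m % b = (m - b) % b := by rw [← Nat.mod_eq_sub_mod hle]
      have key := sum_two_mul_sub_one
        (codeCost K ^ ((m - b) / b) * 3 ^ ((m - b) % b) * 3 ^ k) (by positivity)
        (K.map fun p => p.2)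
      have hsum : ((children b K G (m, k, t)).map (nodeBound b K)).sum =
          ((K.map fun p => p.2).map fun e => 2 * (codeCost K ^ ((m - b) / b) *
            3 ^ ((m - b) % b) * 3 ^ k * 3 ^ e) - 1).sum := by
        simp only [children, extensions, beq_iff_eq, h0, hbm, if_false, List.map_map,
          Function.comp_def, nodeBound, pow_add, mul_assoc]
      rw [hsum]
      have hcost : ((K.map fun p => p.2).map (3 ^ ·)).sum = codeCost K := by
        simp [codeCost, Function.comp_def]
      rw [hcost, List.length_map] at key
      have : codeCost K ^ ((m - b) / b) * 3 ^ ((m - b) % b) * 3 ^ k * codeCost K =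
          codeCost K ^ (m / b) * 3 ^ (m % b) * 3 ^ k := by
        rw [h₁, h₂, pow_succ]; ring
      rw [this] at key
      simp only [nodeBound]
      omega

/-! ### The sizes of the states -/

theorem sz_searchState_le {s : SearchState} (hs : SearchInv r s) :
    sz s ≤ r * (r + 4) + 4 * r + 4 := by
  obtain ⟨m, k, i, a⟩ := s
  obtain ⟨A, hA⟩ := hs.represents
  have h₁ := hs.total
  have h₂ := hs.radius
  have h₃ : sz a ≤ a.length * ((r + 3) + 1) := by
    refine sz_le_length_mul fun p hp => ?_
    obtain ⟨j, v⟩ := p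
    have := ((hA.mem _).1 hp).1
    dsimp only at this h₁
    simp only [sz_pair, sz_nat, sz_fin]
    omega
  have h₄ : a.length = i := hA.length
  dsimp only at h₁ h₂
  have h₅ : a.length * ((r + 3) + 1) ≤ r * (r + 4) := Nat.mul_le_mul (by omega) (by omega)
  simp only [sz_pair, sz_nat]
  omega

/-! ### Programs on the instances -/

/-- The instances with disjoint false clauses. -/
structure Instance where
  /-- the number of variables -/
  n : ℕ
  /-- the formula -/
  F : Formula n
  /-- the centre of the ball -/
  α : Assignment n
  /-- the radius of the ball -/
  r : ℕ
  isCNF : F.IsCNF 3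
  negDisjoint : F.NegDisjoint α r
  /-- the formula as a list -/
  L : List (List (Literal n))
  listsOnce : ListsOnce L F

namespace Instance

instance : Enc Instance := ⟨fun I => encInstance I.n I.L I.α I.r⟩

/-- The instance as raw data. -/
def raw (I : Instance) : ℕ × ℕ × List Bool × List (List RawLiteral) :=
  rawInstance I.n I.L I.α I.r

/-- The constraints of the reduction. -/
def constraints (I : Instance) : List RawConstraint := (reduction I.raw).2

theorem valid_constraints (I : Instance) : ∀ c ∈ I.constraints, Valid 3 I.r c :=
  valid_reduction I.raw (exists_variables I.negDisjoint I.listsOnce).1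

theorem satisfiable_constraints_iff (I : Instance) :
    (∃ A, SatisfiesAll A I.constraints) ↔ InBall I.F I.α I.r :=
  satisfiable_reduction_iff I.isCNF I.negDisjoint I.listsOnce

/-- The raw instance is the same tree, so the identity program computes it. -/
theorem polyC_raw : PolyC raw :=
  PolyC.id.cast fun I => enc_rawInstance I.n I.L I.α I.r

/-- The `r` false clauses have different first variables. -/
theorem r_le (I : Instance) : I.r ≤ I.n := by
  obtain ⟨-, X, hX, -⟩ := exists_variables I.negDisjoint I.listsOnce
  simpa using Fintype.card_le_of_injective (fun i => X i 0) fun i i' h => (hX _ _ _ _ h).1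

/-- Only polynomially many clauses have at most three literals, and none is repeated. Therefore
bounds in the input size turn into bounds in `n`. -/
theorem length_L_le (I : Instance) : I.L.length ≤ 4 * (2 * I.n + 1) ^ 3 := by
  have h₁ : I.L.length = I.F.card := by
    have h := List.toFinset_card_of_nodup I.listsOnce.2.1
    have hF : (I.L.map List.toFinset).toFinset = I.F := I.listsOnce.1
    rw [hF, List.length_map] at h
    exact h.symm
  have h₂ : I.F ⊆ (Finset.range 4).biUnion fun k =>
      Finset.powersetCard k (Finset.univ : Finset (Literal I.n)) := by
    intro C hC
    have := I.isCNF C hC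
    simp only [Finset.mem_biUnion, Finset.mem_range, Finset.mem_powersetCard_univ]
    exact ⟨C.card, by omega, rfl⟩
  rw [h₁]
  refine (Finset.card_le_card h₂).trans (Finset.card_biUnion_le.trans ?_)
  refine (Finset.sum_le_card_nsmul _ _ ((2 * I.n + 1) ^ 3) fun k hk => ?_).trans (by simp)
  rw [Finset.card_powersetCard, Finset.card_univ, Fintype.card_prod, Fintype.card_fin,
    Fintype.card_bool, mul_comm]
  refine (Nat.choose_le_pow _ _).trans ((Nat.pow_le_pow_left (Nat.le_succ _) k).trans ?_)
  exact Nat.pow_le_pow_right (by omega) (by have := Finset.mem_range.1 hk; omega)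

theorem polyB_sz : PolyB (fun I : Instance => I.n) (fun I : Instance => sz I) := by
  let g : Instance → ℕ := fun I =>
    I.n + I.n + I.n * 2 + 4 * (2 * I.n + 1) ^ 3 * (3 * (I.n + 3) + 1) + 3
  have hn : PolyB (fun I : Instance => I.n) fun I => I.n := .refl _
  have hg : PolyB (fun I : Instance => I.n) g :=
    ((((hn.add hn).add (hn.mul (.const _ 2))).add
      (((PolyB.const _ 4).mul ((((PolyB.const _ 2).mul hn).add (.const _ 1)).pow 3)).mul
        (((PolyB.const _ 3).mul (hn.add (.const _ 3))).add (.const _ 1)))).add (.const _ 3))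
  refine hg.of_le fun I => ?_
  have hα : sz (List.ofFn I.α) ≤ I.n * 2 := by
    have := sz_le_length_mul (l := List.ofFn I.α) (M := 1) fun b _ => sz_bool_le b
    simpa using this
  have hL : sz (I.L.map (List.map Literal.raw)) ≤
      4 * (2 * I.n + 1) ^ 3 * (3 * (I.n + 3) + 1) := by
    refine (sz_le_length_mul (M := 3 * (I.n + 3)) fun C hC => ?_).trans
      (by rw [List.length_map]; exact Nat.mul_le_mul_right _ I.length_L_le)
    obtain ⟨D, hD, rfl⟩ := List.mem_map.1 hC
    refine (sz_le_length_mul (M := I.n + 2) fun l hl => ?_).trans (Nat.mul_le_mul_right _ ?_)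
    · obtain ⟨l, -, rfl⟩ := List.mem_map.1 hl
      have h₁ := sz_bool_le l.2
      have h₂ := l.1.2
      simp only [Literal.raw, sz_pair, sz_nat]
      omega
    · rw [List.length_map, ← List.toFinset_card_of_nodup (I.listsOnce.2.2 D hD)]
      exact I.isCNF _ (mem_of_lists I.listsOnce.1 hD)
  have hsz : sz I = sz I.raw := by
    have := enc_rawInstance I.n I.L I.α I.r
    exact congrArg Data.size this.symm
  have hr := I.r_le
  rw [hsz]
  simp only [raw, rawInstance, sz_pair, sz_nat, g]
  omega

/-- Time bounds for functions of the instances give programs. -/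
theorem exists_program {B : Type} [Enc B] {f : Instance → B} {T : Instance → ℕ}
    (h : TimeBound f T) :
    ∃ P : Program, ∀ I : Instance, ∃ t ≤ T I + 2, P.Outputs (enc I) (enc (f I)) t := by
  -- The prefix of length 1 is going to be `e` itself, at index 0. This is not circular, since `e`
  -- and `Q` depend only on the length of the prefix.
  obtain ⟨Q, e, h⟩ := h 1
  refine ⟨[e] ++ Q ++ [], fun I => ?_⟩
  obtain ⟨t, ht, h⟩ := EvalsIn.arg.call (f := 0) (by simp) (h [e] [] rfl I)
  exact ⟨t, by omega, h⟩

/-- A polynomial for a polynomial bound. -/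
theorem exists_polynomial {g : Instance → ℕ} (h : PolyB (fun I : Instance => I.n) g) :
    ∃ p : Polynomial ℕ, ∀ I : Instance, g I ≤ p.eval I.n := by
  obtain ⟨k, hk⟩ := h
  exact ⟨(Polynomial.X + Polynomial.C 2) ^ k, fun I => by simpa using hk I⟩

theorem polyC_constraints : PolyC fun I : Instance => I.constraints :=
  (PolyC.reduction.comp polyC_raw).snd

/-- The reduction. -/
theorem exists_reduction_program :
    ∃ (P : Program) (p : Polynomial ℕ), ∀ I : Instance, ∃ t ≤ p.eval I.n,
      P.Outputs (enc I) (enc (I.r, I.constraints)) t := by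
  obtain ⟨-, T, hT, h⟩ := polyC_raw.snd.fst.pair polyC_constraints
  obtain ⟨P, hP⟩ := exists_program h
  obtain ⟨p, hp⟩ := exists_polynomial ((polyB_sz.trans hT).add (.const _ 2))
  refine ⟨P, p, fun I => ?_⟩
  obtain ⟨t, ht, h⟩ := hP I
  exact ⟨t, ht.trans (hp I), h⟩

open Classical in
/-- The decision procedure. -/
theorem exists_decision_program :
    ∃ (P : Program) (p : Polynomial ℕ), ∀ I : Instance, ∃ t : ℕ,
      (t : ℝ) ≤ ((p.eval I.n : ℕ) : ℝ) * (2.077 : ℝ) ^ I.r ∧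
      P.Outputs (enc I) (enc (decide (InBall I.F I.α I.r))) t := by
  -- `b` and `K` are fixed before the program and do not depend on the instance, so the code is a
  -- constant in it.
  obtain ⟨b, K, hb, hK, hlen, hcost⟩ := exists_covers
  obtain ⟨-, T, ⟨k, hT⟩, hacc⟩ := PolyC.accepting
  obtain ⟨-, U, ⟨l, hU⟩, hch⟩ := PolyC.children b K
  obtain ⟨-, V, hV, hcl⟩ := polyC_constraints.pair ((polyC_raw.snd.fst.pair
    (PolyC.const ((0, 0, []) : ℕ × Partial))).cons (PolyC.const []))
  let S : Instance → ℕ := fun I => sz I.constraints + (I.r * (I.r + 4) + 4 * I.r + 4) + 3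
  let M : Instance → ℕ := fun I => S I ^ k + S I ^ l
  have hr : PolyB (fun I : Instance => I.n) fun I => I.r :=
    (PolyB.refl _).of_le fun I => I.r_le
  have hS : PolyB (fun I : Instance => I.n) S :=
    ((polyB_sz.trans polyC_constraints.1).add (((hr.mul (hr.add (.const _ 4))).add
      ((PolyB.const _ 4).mul hr)).add (.const _ 4))).add (.const _ 3)
  have hM : PolyB (fun I : Instance => I.n) M := (hS.pow k).add (hS.pow l)
  have hstart (I : Instance) : ∀ s ∈ [((I.raw.2.1, 0, 0, []) : SearchState)],
      SearchInv I.r s := by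
    simp only [List.mem_singleton, forall_eq]
    exact searchInv_start I.r
  have hsearch := TimeBound.search hacc hch hcl (Inv := fun I s => SearchInv I.r s)
    (W := fun _ => nodeBound b K) (M := M) hstart (fun I s hs => hs.children hK)
    (fun I s hs => by
      have hsz : sz (I.constraints, s) + 2 ≤ S I := by
        have := sz_searchState_le hs
        simp only [sz_pair, S]
        omega
      exact Nat.add_le_add ((hT _).trans (Nat.pow_le_pow_left hsz k))
        ((hU _).trans (Nat.pow_le_pow_left hsz l)))
    (fun I s _ => sum_nodeBound_children hb hlen I.valid_constraints s)
  have hdecide (I : Instance) : (∃ s ∈ [((I.raw.2.1, 0, 0, []) : SearchState)],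
      Reaches (fun s => accepting I.constraints s) (fun s => children b K I.constraints s) s) ↔
        InBall I.F I.α I.r := by
    rw [← I.satisfiable_constraints_iff]
    constructor
    · rintro ⟨s, hs, h⟩
      exact sound_of_reaches hK I.valid_constraints (hstart I s hs) h
    · rintro ⟨A, hA⟩
      refine ⟨_, List.mem_singleton_self _, ?_⟩
      exact reaches_of_satisfiesAll hb hK hA I.valid_constraints I.r (represents_empty A)
        (by simp) (by simp [prefixDist])
  simp only [hdecide] at hsearch
  obtain ⟨P, hP⟩ := exists_program hsearch
  obtain ⟨p, hp⟩ := exists_polynomial (((polyB_sz.trans hV).add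
    (((PolyB.const _ (2 * 3 ^ b)).mul (hM.add (.const _ 40))))).add (.const _ 12))
  refine ⟨P, p, fun I => ?_⟩
  obtain ⟨t, ht, h⟩ := hP I
  refine ⟨t, ?_, h⟩
  -- The `r / b` full blocks cost at most `2.077 ^ b` each; the `r % b` leftover variables
  -- contribute a factor of at most the constant `3 ^ b`.
  have hnodes : (nodeBound b K (I.raw.2.1, 0, 0, []) : ℝ) ≤ 2 * 3 ^ b * 2.077 ^ I.r := by
    change ((2 * (codeCost K ^ (I.r / b) * 3 ^ (I.r % b) * 3 ^ 0) - 1 : ℕ) : ℝ) ≤ _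
    refine (Nat.cast_le.2 (Nat.sub_le _ 1)).trans ?_
    push_cast
    have h₁ : (codeCost K : ℝ) ^ (I.r / b) ≤ 2.077 ^ I.r := by
      refine (pow_le_pow_left₀ (by positivity) hcost _).trans ?_
      rw [← pow_mul]
      exact pow_le_pow_right₀ (by norm_num) (Nat.mul_div_le _ _)
    have h₂ : (3 : ℝ) ^ (I.r % b) ≤ 3 ^ b :=
      pow_le_pow_right₀ (by norm_num) (Nat.mod_lt _ hb).le
    calc (2 : ℝ) * ((codeCost K : ℝ) ^ (I.r / b) * 3 ^ (I.r % b) * 3 ^ 0)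
        ≤ 2 * (2.077 ^ I.r * 3 ^ b * 3 ^ 0) := by gcongr
      _ = _ := by ring
  have hone : (1 : ℝ) ≤ 2.077 ^ I.r := one_le_pow₀ (by norm_num)
  have ht' : (t : ℝ) ≤ V I + nodeBound b K (I.raw.2.1, 0, 0, []) * (M I + 40) + 12 := by
    have : t ≤ V I + nodeBound b K (I.raw.2.1, 0, 0, []) * (M I + 40) + 12 := by
      simpa [add_assoc] using ht
    exact_mod_cast this
  have hp' : (V I + 2 * 3 ^ b * (M I + 40) + 12 : ℝ) ≤ (p.eval I.n : ℕ) := by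
    exact_mod_cast hp I
  calc (t : ℝ) ≤ V I + nodeBound b K (I.raw.2.1, 0, 0, []) * (M I + 40) + 12 := ht'
    _ ≤ V I + 2 * 3 ^ b * 2.077 ^ I.r * (M I + 40) + 12 := by gcongr
    _ ≤ V I * 2.077 ^ I.r + 2 * 3 ^ b * 2.077 ^ I.r * (M I + 40) + 12 * 2.077 ^ I.r := by
        gcongr
        · exact le_mul_of_one_le_right (by positivity) hone
        · linarith
    _ = (V I + 2 * 3 ^ b * (M I + 40) + 12) * 2.077 ^ I.r := by ring
    _ ≤ _ := by gcongr

end Instance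

/-! ### Constraints over a finite set of variables -/

/-- A literal of a constraint as raw data. -/
def rawCSPLiteral {r : ℕ} (p : Fin r × Fin 3) : ℕ × Fin 3 := (p.1, p.2)

theorem exists_map_rawCSPLiteral {k r : ℕ} {X : List RawConstraint} (hX : ∀ c ∈ X, Valid k r c) :
    ∃ L : List (List (Fin r × Fin 3)), L.map (List.map rawCSPLiteral) = X := by
  change X ∈ Set.range (List.map (List.map rawCSPLiteral))
  rw [Set.range_list_map, Set.mem_ofPred_eq]
  intro c hc
  rw [Set.range_list_map, Set.mem_ofPred_eq]
  rintro ⟨i, j⟩ hp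
  exact ⟨(⟨i, (hX c hc).2 _ hp⟩, j), rfl⟩

theorem satisfiable_iff {r : ℕ} (L : List (List (Fin r × Fin 3))) :
    CSP.Satisfiable (L.map List.toFinset).toFinset ↔
      ∃ A, SatisfiesAll A (L.map (List.map rawCSPLiteral)) := by
  simp only [CSP.Satisfiable, SatisfiesAll, List.mem_toFinset, List.mem_map,
    forall_exists_index, and_imp, forall_apply_eq_imp_iff₂, exists_exists_and_eq_and,
    rawCSPLiteral]
  constructor
  · rintro ⟨a, ha⟩
    exact ⟨fun i => if h : i < r then a ⟨i, h⟩ else 0, by simpa using ha⟩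
  · rintro ⟨A, hA⟩
    exact ⟨fun i => A i, hA⟩

end BallSat

open BallSat in
/-- On the instances `(F, α, r)` of Ball-3-SAT for which `Neg(F)` consists of exactly `r` pairwise
disjoint 3-clauses: a program reduces them in polynomial time to (3,3)-CSP formulas over `r`
ternary variables, and a program decides them in time `O*(2.077 ^ r)`. -/
theorem lemma2 :
    (∃ (P : Program) (p : Polynomial ℕ),
      ∀ (n : ℕ) (F : Formula n) (α : Assignment n) (r : ℕ),
        F.IsCNF 3 → F.NegDisjoint α r →
        ∀ L : List (List (Literal n)), ListsOnce L F →
          ∃ (G : CSP 3 r) (L' : List (List (Fin r × Fin 3))) (t : ℕ),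
            G.HasWidth 3 ∧ (G.Satisfiable ↔ InBall F α r) ∧
            Lists L' G ∧ P.Outputs (encInstance n L α r) (encCSP 3 r L') t ∧
            t ≤ p.eval n) ∧
    (∃ (P : Program) (p : Polynomial ℕ),
      ∀ (n : ℕ) (F : Formula n) (α : Assignment n) (r : ℕ),
        F.IsCNF 3 → F.NegDisjoint α r →
        ∀ L : List (List (Literal n)), ListsOnce L F →
          ∃ (v : Data) (t : ℕ),
            P.Outputs (encInstance n L α r) v t ∧ (v ≠ Data.nil ↔ InBall F α r) ∧
            (t : ℝ) ≤ ((p.eval n : ℕ) : ℝ) * (2.077 : ℝ) ^ r) := by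
  constructor
  · obtain ⟨P, p, h⟩ := Instance.exists_reduction_program
    refine ⟨P, p, fun n F α r hF hN L hL => ?_⟩
    let I : Instance := ⟨n, F, α, r, hF, hN, L, hL⟩
    obtain ⟨t, ht, h⟩ := h I
    obtain ⟨L', hL'⟩ := exists_map_rawCSPLiteral I.valid_constraints
    refine ⟨_, L', t, ?_, ?_, rfl, ?_, ht⟩
    · intro C hC
      obtain ⟨c, hc, rfl⟩ := List.mem_map.1 (List.mem_toFinset.1 hC)
      refine (List.toFinset_card_le c).trans ?_
      have := (I.valid_constraints (c.map rawCSPLiteral) (hL' ▸ List.mem_map_of_mem hc)).1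
      simpa using this
    · rw [satisfiable_iff, hL', I.satisfiable_constraints_iff]
    · have : Enc.enc (I.r, I.constraints) = encCSP 3 r L' := by
        rw [← hL']
        change Data.cons _ (encList (encList Enc.enc) (L'.map (List.map rawCSPLiteral))) = _
        simp only [encList_map]
        rfl
      rw [← this]
      exact h
  · obtain ⟨P, p, h⟩ := Instance.exists_decision_program
    refine ⟨P, p, fun n F α r hF hN L hL => ?_⟩
    obtain ⟨t, ht, h⟩ := h ⟨n, F, α, r, hF, hN, L, hL⟩
    refine ⟨_, t, h, ?_, ht⟩
    by_cases hB : InBall F α r <;> simp [hB]
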